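/- For $v\in\mathbb C$ put $$x(v)=\frac{v}{1+5v+8v^2},\qquad z(v)=\frac{x(v)}{(1+x(v))^2},$$ and let $$u_n=\sum_{k=0}^n\binom nk^2\binom{n+k}n\binom{2k}n\quad(n\ge 0),\qquad u_{-1}=0 .$$ (a) For all $v$ in some neighbourhood of $0$ one has $$z(v)=\frac{v(1+5v+8v^2)}{(1+2v)^2(1+4v)^2},$$ the following series converge absolutely, and $$\sum_{n=0}^\infty\binom{2n}n z(v)^n\sum_{k=0}^n\binom nk\binom{n+k}n\binom{2k}k x(v)^k=\frac{1+2v}{1+4v}\sum_{n=0}^\infty u_n\biggl(\frac{v}{(1+4v)^3}\biggr)^n .$$ (b) For every $n\ge 0$, $$u_n=\sum_{k=0}^n(-1)^{n-k}\binom{3n+1}{n-k}\binom{n+k}n^3 .$$ (c) $u_0=1$, and for all $n=0,1,2,\dots$ $$(n+1)^3u_{n+1}=(2n+1)(13n^2+13n+4)\,u_n+3n(3n-1)(3n+1)\,u_{n-1}.$$ (d) Let $P_n(y)={}_2F_1\bigl(-n,n+1;1;\tfrac{1-y}2\bigr)$ be the Legendre polynomials and $y(v)=\sqrt{(1+v)(1+8v)}\big/\sqrt{1+5v+8v^2}$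 (principal square roots). Then for all $v$ in some neighbourhood of $0$ one has $y(v)^2=1+4x(v)$ and the identity in (a) takes the equivalent form $$\sum_{n=0}^\infty\binom{2n}n P_n\bigl(y(v)\bigr)^2\biggl(\frac{v(1+5v+8v^2)}{(1+2v)^2(1+4v)^2}\biggr)^n=\frac{1+2v}{1+4v}\sum_{n=0}^\infty u_n\biggl(\frac{v}{(1+4v)^3}\biggr)^n ,$$ again with absolutely convergent series. -/

import Mathlib

open Filter Topology

noncomputable section

/-- The Legendre function `P_n(y) = ₂F₁(-n, n + 1; 1; (1 - y)/2)`; the series terminates. -/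
def legendreP (n : ℕ) (y : ℂ) : ℂ :=
  ordinaryHypergeometric (-(n : ℂ)) ((n : ℂ) + 1) 1 ((1 - y) / 2)

/-- `x(v) = v / (1 + 5v + 8v²)`. -/
def xParam (v : ℂ) : ℂ := v / (1 + 5 * v + 8 * v ^ 2)

/-- `z(v) = x(v) / (1 + x(v))²`. -/
def zParam (v : ℂ) : ℂ := xParam v / (1 + xParam v) ^ 2

/-- `y(v) = √((1 + v)(1 + 8v)) / √(1 + 5v + 8v²)`, with principal square roots. -/
def yParam (v : ℂ) : ℂ :=
  Complex.sqrt ((1 + v) * (1 + 8 * v)) / Complex.sqrt (1 + 5 * v + 8 * v ^ 2)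

/-- `∑_{k=0}^n C(n,k) C(n+k,n) C(2k,k) x^k`. -/
def innerSum (n : ℕ) (x : ℂ) : ℂ :=
  ∑ k ∈ Finset.range (n + 1),
    (n.choose k : ℂ) * ((n + k).choose n : ℂ) * ((2 * k).choose k : ℂ) * x ^ k

end

/-- `u_n = ∑_{k=0}^n C(n,k)² C(n+k,n) C(2k,n)` for `n ≥ 0`. -/
def aperyNat (n : ℕ) : ℤ :=
  ∑ k ∈ Finset.range (n + 1),
    (n.choose k : ℤ) ^ 2 * ((n + k).choose n : ℤ) * ((2 * k).choose n : ℤ)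

/-- The sequence `u_n` over all integer indices, with `u_n = 0` for `n < 0`. -/
def apery : ℤ → ℤ
  | .ofNat n => aperyNat n
  | .negSucc _ => 0

/-! ### Binomial coefficient relations over `ℚ` -/

/-! The two binomial sums for `u_n` agree because creative telescoping gives them the same
second-order recurrence. For each summand, the recurrence operator in `n` turns it into a difference
in `k` of an explicit certificate (`aperyCert`, `altCert`), so the summed operator vanishes.
Equality of the first two values then finishes parts (b) and (c).

For the generating functions, divide both sides by `1 + x` and show that the third-order operator
`odeForm` in `θ = x d/dx` annihilates each. On the left, write `y² = 1 + 4x`. The polynomials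
`P_n²`, `P_n P_{n-1} / y` and `P_{n-1}²` in `x` (`innerSum`, `mixedSum`, `prevSum`) span a
rank-three module stable under `θ` and under `n ↦ n + 1`. Inside it, the image of the `n`-th term is
a difference in `n` of `leftCert` (`odeForm_leftTerm`). This certificate vanishes at `n = 0` and
tends to `0`. On the right, pulling `θ` back to `v` turns the operator, up to a common factor, into
the one that encodes the recurrence of `u_n` in powers of `t = v / (1 + 4v)³` (`odeForm_log`). The
sum therefore telescopes to `0` as well (`tendsto_sum_aperyForm`).

The difference of the two sides is thus an analytic solution that vanishes at the origin. The
indicial polynomial there is `s³`, whose only root is `0`, so the difference is identically zero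
(`eventually_eq_zero_of_euler_ode`). Part (d) follows termwise from `legendreP_sq`: `P_n(y)²`
depends only on `y²`, so the choice of square roots does not matter. -/

theorem cast_choose_succ_succ (a b : ℕ) :
    ((b : ℚ) + 1) * ((a + 1).choose (b + 1) : ℚ) = (a + 1) * (a.choose b : ℚ) := by
  have h := Nat.add_one_mul_choose_eq a b
  have h' : ((a : ℚ) + 1) * (a.choose b : ℚ) = ((a + 1).choose (b + 1) : ℚ) * (b + 1) := by
    exact_mod_cast h
  linarith

theorem cast_choose_succ_left (a b : ℕ) :
    ((a : ℚ) + 1 - b) * ((a + 1).choose b : ℚ) = (a + 1) * (a.choose b : ℚ) := by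
  rcases le_or_gt b (a + 1) with h | h
  · have h1 := Nat.choose_mul_succ_eq a b
    have h2 : (a.choose b : ℚ) * (a + 1) = ((a + 1).choose b : ℚ) * ((a + 1 - b : ℕ) : ℚ) := by
      exact_mod_cast h1
    rw [Nat.cast_sub h] at h2
    push_cast at h2
    linarith
  · rw [Nat.choose_eq_zero_of_lt h, Nat.choose_eq_zero_of_lt (by omega)]
    simp

theorem cast_choose_succ_right (a b : ℕ) :
    ((b : ℚ) + 1) * (a.choose (b + 1) : ℚ) = (a - b) * (a.choose b : ℚ) := by
  have h1 := cast_choose_succ_succ a b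
  have h2 : ((a + 1).choose (b + 1) : ℚ) = a.choose b + a.choose (b + 1) := by
    exact_mod_cast Nat.choose_succ_succ a b
  rw [h2] at h1
  linarith

/-- A sum whose `k`-th term is `H k - H (k - 1)` telescopes. -/
theorem sum_range_eq_of_telescope {f H : ℕ → ℚ} (h0 : f 0 = H 0)
    (hs : ∀ k, f (k + 1) = H (k + 1) - H k) (n : ℕ) :
    ∑ k ∈ Finset.range (n + 1), f k = H n := by
  induction n with
  | zero => simp [h0]
  | succ n ih => rw [Finset.sum_range_succ, ih, hs]; ring

/-! ### The first binomial sum -/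

/-- The summand `C(n,k)² C(n+k,n) C(2k,n)`. -/
def aperyTerm (n k : ℕ) : ℚ :=
  (n.choose k : ℚ) ^ 2 * ((n + k).choose n : ℚ) * ((2 * k).choose n : ℚ)

/-- The telescoping certificate for `aperyTerm`. -/
def aperyCert (n k : ℕ) : ℚ :=
  2 * (n.choose k : ℚ) ^ 2 * ((n + k).choose n : ℚ) * ((2 * k + 1).choose n : ℚ) *
    (4 + 15 * n + 18 * n ^ 2 + 7 * n ^ 3 - (13 + 39 * n + 26 * n ^ 2) * (k + 1) +
      (7 + 15 * n) * (k + 1) ^ 2)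

/-- Only `m = 0` needs arithmetic: for larger `m` the factors `C(0, ·)` and `C(1, m + 1)` kill every
term. -/
theorem aperyTerm_telescope_zero (m : ℕ) :
    ((m : ℚ) + 2) ^ 3 * aperyTerm (m + 2) 0 -
      (2 * m + 3) * (13 * (m + 1) ^ 2 + 13 * (m + 1) + 4) * aperyTerm (m + 1) 0 -
      3 * (m + 1) * (3 * m + 2) * (3 * m + 4) * aperyTerm m 0 = aperyCert (m + 1) 0 := by
  rcases m with _ | m
  · simp [aperyTerm, aperyCert]; norm_num
  · simp [aperyTerm, aperyCert, Nat.choose_eq_zero_of_lt (show 1 < m + 1 + 1 by omega)]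

/-- Each binomial coefficient is a polynomial multiple of one of three base quantities `p`, `q`,
`r`, after which the identity is polynomial. -/
theorem aperyTerm_telescope_succ (m j : ℕ) :
    ((m : ℚ) + 2) ^ 3 * aperyTerm (m + 2) (j + 1) -
      (2 * m + 3) * (13 * (m + 1) ^ 2 + 13 * (m + 1) + 4) * aperyTerm (m + 1) (j + 1) -
      3 * (m + 1) * (3 * m + 2) * (3 * m + 4) * aperyTerm m (j + 1) =
      aperyCert (m + 1) (j + 1) - aperyCert (m + 1) j := by
  have hm1 : (m : ℚ) + 1 ≠ 0 := by positivity
  have hm2 : (m : ℚ) + 2 ≠ 0 := by positivity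
  have hj1 : (j : ℚ) + 1 ≠ 0 := by positivity
  have hj2 : 2 * (j : ℚ) + 3 ≠ 0 := by positivity
  have hmj2 : (m : ℚ) + j + 2 ≠ 0 := by positivity
  have hmj3 : (m : ℚ) + j + 3 ≠ 0 := by positivity
  -- The base is chosen so that one divides only by factors that never vanish; factors such as `m +
  -- 1 - j`, which can be zero, appear only as multipliers.
  obtain ⟨q, hq⟩ : ∃ q : ℚ, ((m + 2).choose (j + 1) : ℚ) = (m + 2) * (m + 1) * q :=
    ⟨((m + 2).choose (j + 1) : ℚ) / ((m + 2) * (m + 1)), by field_simp⟩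
  have q1 : ((m + 1).choose (j + 1) : ℚ) = (m + 1) * (m + 1 - j) * q := by
    have h := cast_choose_succ_left (m + 1) (j + 1)
    push_cast at h
    apply mul_left_cancel₀ hm2
    rw [hq] at h
    linear_combination -h
  have q2 : (m.choose (j + 1) : ℚ) = (m - j) * (m + 1 - j) * q := by
    have h := cast_choose_succ_left m (j + 1)
    push_cast at h
    apply mul_left_cancel₀ hm1
    rw [q1] at h
    linear_combination -h
  have q3 : ((m + 1).choose j : ℚ) = (m + 1) * (j + 1) * q := by
    have h := cast_choose_succ_succ (m + 1) j
    push_cast at h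
    apply mul_left_cancel₀ hm2
    rw [hq] at h
    linear_combination -h
  obtain ⟨p, hp⟩ : ∃ p : ℚ, ((m + 2 + (j + 1)).choose (m + 2) : ℚ) = (m + j + 3) * (m + j + 2) * p :=
    ⟨((m + 2 + (j + 1)).choose (m + 2) : ℚ) / ((m + j + 3) * (m + j + 2)), by field_simp⟩
  have p1 : ((m + 1 + (j + 1)).choose (m + 1) : ℚ) = (m + j + 2) * (m + 2) * p := by
    have h := cast_choose_succ_succ (m + 1 + (j + 1)) (m + 1)
    rw [show m + 1 + (j + 1) + 1 = m + 2 + (j + 1) by ring, hp] at h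
    push_cast at h
    apply mul_left_cancel₀ hmj3
    linear_combination -h
  have p2 : ((m + (j + 1)).choose m : ℚ) = (m + 2) * (m + 1) * p := by
    have h := cast_choose_succ_succ (m + (j + 1)) m
    rw [show m + (j + 1) + 1 = m + 1 + (j + 1) by ring, p1] at h
    push_cast at h
    apply mul_left_cancel₀ hmj2
    linear_combination -h
  have p3 : ((m + 1 + j).choose (m + 1) : ℚ) = (m + 2) * (j + 1) * p := by
    have h := cast_choose_succ_left (m + 1 + j) (m + 1)
    rw [show m + 1 + j + 1 = m + 1 + (j + 1) by ring, p1] at h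
    push_cast at h
    apply mul_left_cancel₀ hmj2
    linear_combination -h
  obtain ⟨r, hr⟩ : ∃ r : ℚ, ((2 * (j + 1) + 1).choose (m + 1) : ℚ) =
      (2 * j + 3) * (2 * j + 2) * (m + 2) * r :=
    ⟨((2 * (j + 1) + 1).choose (m + 1) : ℚ) / ((2 * j + 3) * (2 * j + 2) * (m + 2)), by field_simp⟩
  have r1 : ((2 * (j + 1)).choose (m + 1) : ℚ) = (2 * j + 2) * (m + 2) * (2 * j + 2 - m) * r := by
    have h := cast_choose_succ_left (2 * (j + 1)) (m + 1)
    rw [hr] at h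
    push_cast at h
    apply mul_left_cancel₀ hj2
    linear_combination -h
  have r0 : ((2 * (j + 1)).choose (m + 2) : ℚ) =
      (2 * j + 2) * (2 * j + 2 - m) * (2 * j + 1 - m) * r := by
    have h := cast_choose_succ_right (2 * (j + 1)) (m + 1)
    rw [r1] at h
    push_cast at h
    apply mul_left_cancel₀ hm2
    linear_combination h
  have r2 : ((2 * (j + 1)).choose m : ℚ) = (2 * j + 2) * (m + 2) * (m + 1) * r := by
    have h := cast_choose_succ_succ (2 * (j + 1)) m
    rw [hr] at h
    push_cast at h
    apply mul_left_cancel₀ hj2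
    linear_combination -h
  have r3 : ((2 * j + 1).choose (m + 1) : ℚ) = (m + 2) * (2 * j + 2 - m) * (2 * j + 1 - m) * r := by
    have h := cast_choose_succ_left (2 * j + 1) (m + 1)
    rw [show 2 * j + 1 + 1 = 2 * (j + 1) by ring, r1] at h
    push_cast at h
    apply mul_left_cancel₀ hj1
    linear_combination -h / 2
  simp only [aperyTerm, aperyCert]
  rw [hq, q1, q2, q3, hp, p1, p2, p3, r0, r1, r2, hr, r3]
  push_cast
  ring

theorem aperyTerm_eq_zero {n k : ℕ} (h : n < k) : aperyTerm n k = 0 := by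
  simp [aperyTerm, Nat.choose_eq_zero_of_lt h]

theorem sum_aperyTerm_of_le {n N : ℕ} (h : n ≤ N) :
    ∑ k ∈ Finset.range (N + 1), aperyTerm n k = ∑ k ∈ Finset.range (n + 1), aperyTerm n k := by
  symm
  apply Finset.sum_subset
  · intro k hk; simp only [Finset.mem_range] at *; omega
  · intro k _ hk
    exact aperyTerm_eq_zero (by simp only [Finset.mem_range] at hk; omega)

theorem aperyNat_cast (n : ℕ) :
    (aperyNat n : ℚ) = ∑ k ∈ Finset.range (n + 1), aperyTerm n k := by
  simp [aperyNat, aperyTerm]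

theorem aperyNat_recurrence_rat (m : ℕ) :
    ((m : ℚ) + 2) ^ 3 * aperyNat (m + 2) =
      (2 * m + 3) * (13 * (m + 1) ^ 2 + 13 * (m + 1) + 4) * aperyNat (m + 1) +
      3 * (m + 1) * (3 * m + 2) * (3 * m + 4) * aperyNat m := by
  have h := sum_range_eq_of_telescope (f := fun k => ((m : ℚ) + 2) ^ 3 * aperyTerm (m + 2) k -
      (2 * m + 3) * (13 * (m + 1) ^ 2 + 13 * (m + 1) + 4) * aperyTerm (m + 1) k -
      3 * (m + 1) * (3 * m + 2) * (3 * m + 4) * aperyTerm m k) (H := aperyCert (m + 1))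
    (aperyTerm_telescope_zero m) (aperyTerm_telescope_succ m)
    (m + 2)
  rw [Finset.sum_sub_distrib, Finset.sum_sub_distrib, ← Finset.mul_sum, ← Finset.mul_sum,
    ← Finset.mul_sum, sum_aperyTerm_of_le (show m + 1 ≤ m + 2 by omega),
    sum_aperyTerm_of_le (show m ≤ m + 2 by omega)] at h
  -- The upper boundary term contains `C(m + 1, m + 2)`.
  have h0 : aperyCert (m + 1) (m + 2) = 0 := by
    simp [aperyCert]
  rw [h0, ← aperyNat_cast, ← aperyNat_cast, ← aperyNat_cast] at h
  linarith

/-! ### The second binomial sum -/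

/-- The summand `(-1)^(n-k) C(3n+1,n-k) C(n+k,n)³`, in a form valid for all `k`. -/
def altTerm (n k : ℕ) : ℚ :=
  (-1) ^ (n + k) * ((3 * n + 1).choose (2 * n + 1 + k) : ℚ) * ((n + k).choose n : ℚ) ^ 3

/-- The polynomial factor of the telescoping certificate for `altTerm`. -/
def altPoly (n k : ℚ) : ℚ :=
  46 * n ^ 2 + 190 * n ^ 3 + 259 * n ^ 4 + 115 * n ^ 5 +
    k * (70 * n + 321 * n ^ 2 + 488 * n ^ 3 + 244 * n ^ 4) +
    k ^ 2 * (28 + 165 * n + 300 * n ^ 2 + 175 * n ^ 3) + k ^ 3 * (20 + 57 * n + 42 * n ^ 2)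

/-- The telescoping certificate for `altTerm`. -/
def altCert (n k : ℕ) : ℚ :=
  -(-1) ^ (n + k) * ((3 * n + 3).choose (2 * n + 3 + k) : ℚ) / ((3 * n + 3) * (3 * n + 2)) *
    ((n + k).choose n : ℚ) ^ 3 * altPoly n (k + 1)

/-- The subtracted term is the certificate at `k - 1`, rewritten without a predecessor. At `k = 0`
it vanishes through `C(m, m + 1)`, so one computation serves both cases of the telescoping. -/
theorem altTerm_telescope_aux (m k : ℕ) :
    ((m : ℚ) + 2) ^ 3 * altTerm (m + 2) k -
      (2 * m + 3) * (13 * (m + 1) ^ 2 + 13 * (m + 1) + 4) * altTerm (m + 1) k -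
      3 * (m + 1) * (3 * m + 2) * (3 * m + 4) * altTerm m k =
      altCert (m + 1) k - (-1) ^ (m + 1 + k) * ((3 * m + 6).choose (2 * m + 4 + k) : ℚ) /
        ((3 * m + 6) * (3 * m + 5)) * ((m + k).choose (m + 1) : ℚ) ^ 3 * altPoly (m + 1) k := by
  have hm2 : (m : ℚ) + 2 ≠ 0 := by positivity
  have hm1 : (m : ℚ) + 1 ≠ 0 := by positivity
  have hmk1 : (m : ℚ) + k + 1 ≠ 0 := by positivity
  have hmk2 : (m : ℚ) + k + 2 ≠ 0 := by positivity
  have a7 : 3 * (m : ℚ) + 7 ≠ 0 := by positivity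
  have a6 : 3 * (m : ℚ) + 6 ≠ 0 := by positivity
  have a5 : 3 * (m : ℚ) + 5 ≠ 0 := by positivity
  have a4 : 3 * (m : ℚ) + 4 ≠ 0 := by positivity
  have a3 : 3 * (m : ℚ) + 3 ≠ 0 := by positivity
  have a2 : 3 * (m : ℚ) + 2 ≠ 0 := by positivity
  obtain ⟨p, hp⟩ : ∃ p : ℚ, ((m + 2 + k).choose (m + 2) : ℚ) = (m + k + 2) * (m + k + 1) * p :=
    ⟨((m + 2 + k).choose (m + 2) : ℚ) / ((m + k + 2) * (m + k + 1)), by field_simp⟩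
  have p1 : ((m + 1 + k).choose (m + 1) : ℚ) = (m + k + 1) * (m + 2) * p := by
    have h := cast_choose_succ_succ (m + 1 + k) (m + 1)
    rw [show m + 1 + k + 1 = m + 2 + k by ring, hp] at h
    push_cast at h
    apply mul_left_cancel₀ hmk2
    linear_combination -h
  have p2 : ((m + k).choose m : ℚ) = (m + 2) * (m + 1) * p := by
    have h := cast_choose_succ_succ (m + k) m
    rw [show m + k + 1 = m + 1 + k by ring, p1] at h
    push_cast at h
    apply mul_left_cancel₀ hmk1
    linear_combination -h
  have p3 : ((m + k).choose (m + 1) : ℚ) = (m + 2) * k * p := by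
    have h := cast_choose_succ_left (m + k) (m + 1)
    rw [show m + k + 1 = m + 1 + k by ring, p1] at h
    push_cast at h
    apply mul_left_cancel₀ hmk1
    linear_combination -h
  obtain ⟨q, hq⟩ : ∃ q : ℚ, ((3 * (m + 2) + 1).choose (2 * (m + 2) + 1 + k) : ℚ) =
      (3 * m + 7) * (3 * m + 6) * (3 * m + 5) * (3 * m + 4) * (3 * m + 3) * (3 * m + 2) * q :=
    ⟨((3 * (m + 2) + 1).choose (2 * (m + 2) + 1 + k) : ℚ) / ((3 * m + 7) * (3 * m + 6) *
      (3 * m + 5) * (3 * m + 4) * (3 * m + 3) * (3 * m + 2)), by field_simp⟩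
  have c3 : ((3 * (m + 1) + 3).choose (2 * (m + 1) + 3 + k) : ℚ) =
      (3 * m + 6) * (3 * m + 5) * (3 * m + 4) * (3 * m + 3) * (3 * m + 2) * (m + 2 - k) * q := by
    have h := cast_choose_succ_left (3 * (m + 1) + 3) (2 * (m + 1) + 3 + k)
    rw [show 3 * (m + 1) + 3 + 1 = 3 * (m + 2) + 1 by ring,
      show 2 * (m + 1) + 3 + k = 2 * (m + 2) + 1 + k by ring, hq] at h
    rw [show 2 * (m + 1) + 3 + k = 2 * (m + 2) + 1 + k by ring]
    push_cast at h
    apply mul_left_cancel₀ a7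
    linear_combination -h
  have c4 : ((3 * m + 6).choose (2 * m + 4 + k) : ℚ) =
      (3 * m + 6) * (3 * m + 5) * (3 * m + 4) * (3 * m + 3) * (3 * m + 2) * (2 * m + 5 + k) * q := by
    have h := cast_choose_succ_succ (3 * m + 6) (2 * m + 4 + k)
    rw [show 3 * m + 6 + 1 = 3 * (m + 2) + 1 by ring,
      show 2 * m + 4 + k + 1 = 2 * (m + 2) + 1 + k by ring, hq] at h
    push_cast at h
    apply mul_left_cancel₀ a7
    linear_combination -h
  have d5 : ((3 * m + 5).choose (2 * m + 4 + k) : ℚ) =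
      (3 * m + 5) * (3 * m + 4) * (3 * m + 3) * (3 * m + 2) * (2 * m + 5 + k) * (m + 2 - k) * q := by
    have h := cast_choose_succ_left (3 * m + 5) (2 * m + 4 + k)
    rw [show 3 * m + 5 + 1 = 3 * m + 6 by ring, c4] at h
    push_cast at h
    apply mul_left_cancel₀ a6
    linear_combination -h
  have c1 : ((3 * (m + 1) + 1).choose (2 * (m + 1) + 1 + k) : ℚ) =
      (3 * m + 4) * (3 * m + 3) * (3 * m + 2) * (2 * m + 5 + k) * (2 * m + 4 + k) *
        (m + 2 - k) * q := by
    have h := cast_choose_succ_succ (3 * m + 4) (2 * m + 3 + k)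
    rw [show 3 * m + 4 + 1 = 3 * m + 5 by ring,
      show 2 * m + 3 + k + 1 = 2 * m + 4 + k by ring, d5] at h
    rw [show 3 * (m + 1) + 1 = 3 * m + 4 by ring, show 2 * (m + 1) + 1 + k = 2 * m + 3 + k by ring]
    push_cast at h
    apply mul_left_cancel₀ a5
    linear_combination -h
  have d3 : ((3 * m + 3).choose (2 * m + 2 + k) : ℚ) =
      (3 * m + 3) * (3 * m + 2) * (2 * m + 5 + k) * (2 * m + 4 + k) * (2 * m + 3 + k) *
        (m + 2 - k) * q := by
    have h := cast_choose_succ_succ (3 * m + 3) (2 * m + 2 + k)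
    rw [show 3 * m + 3 + 1 = 3 * (m + 1) + 1 by ring,
      show 2 * m + 2 + k + 1 = 2 * (m + 1) + 1 + k by ring, c1] at h
    push_cast at h
    apply mul_left_cancel₀ a4
    linear_combination -h
  have d2 : ((3 * m + 2).choose (2 * m + 1 + k) : ℚ) =
      (3 * m + 2) * (2 * m + 5 + k) * (2 * m + 4 + k) * (2 * m + 3 + k) * (2 * m + 2 + k) *
        (m + 2 - k) * q := by
    have h := cast_choose_succ_succ (3 * m + 2) (2 * m + 1 + k)
    rw [show 3 * m + 2 + 1 = 3 * m + 3 by ring,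
      show 2 * m + 1 + k + 1 = 2 * m + 2 + k by ring, d3] at h
    push_cast at h
    apply mul_left_cancel₀ a3
    linear_combination -h
  have c2 : ((3 * m + 1).choose (2 * m + 1 + k) : ℚ) =
      (2 * m + 5 + k) * (2 * m + 4 + k) * (2 * m + 3 + k) * (2 * m + 2 + k) *
        (m + 2 - k) * (m + 1 - k) * q := by
    have h := cast_choose_succ_left (3 * m + 1) (2 * m + 1 + k)
    rw [show 3 * m + 1 + 1 = 3 * m + 2 by ring, d2] at h
    push_cast at h
    apply mul_left_cancel₀ a2
    linear_combination -h
  simp only [altTerm, altCert]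
  rw [hp, p1, p2, p3, hq, c1, c2, c3, c4]
  simp only [altPoly]
  rw [show m + 2 + k = (m + k) + 2 by ring, show m + 1 + k = (m + k) + 1 by ring]
  push_cast
  rw [show 3 * ((m : ℚ) + 1) + 3 = 3 * m + 6 by ring, show 3 * ((m : ℚ) + 1) + 2 = 3 * m + 5 by ring]
  -- All signs are reduced to the common `(-1) ^ (m + k)`, which then acts as a free scalar.
  rw [show (-1 : ℚ) ^ (m + k + 2) = (-1) ^ (m + k) by rw [pow_add]; norm_num,
    show (-1 : ℚ) ^ (m + k + 1) = -(-1) ^ (m + k) by rw [pow_succ]; ring]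
  generalize (-1 : ℚ) ^ (m + k) = e
  field_simp
  ring

theorem altTerm_telescope_zero (m : ℕ) :
    ((m : ℚ) + 2) ^ 3 * altTerm (m + 2) 0 -
      (2 * m + 3) * (13 * (m + 1) ^ 2 + 13 * (m + 1) + 4) * altTerm (m + 1) 0 -
      3 * (m + 1) * (3 * m + 2) * (3 * m + 4) * altTerm m 0 = altCert (m + 1) 0 := by
  rw [altTerm_telescope_aux]
  simp

theorem altTerm_telescope_succ (m j : ℕ) :
    ((m : ℚ) + 2) ^ 3 * altTerm (m + 2) (j + 1) -
      (2 * m + 3) * (13 * (m + 1) ^ 2 + 13 * (m + 1) + 4) * altTerm (m + 1) (j + 1) -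
      3 * (m + 1) * (3 * m + 2) * (3 * m + 4) * altTerm m (j + 1) =
      altCert (m + 1) (j + 1) - altCert (m + 1) j := by
  rw [altTerm_telescope_aux]
  congr 1
  simp only [altCert]
  rw [show 3 * (m + 1) + 3 = 3 * m + 6 by ring,
    show 2 * (m + 1) + 3 + j = 2 * m + 4 + (j + 1) by ring,
    show m + (j + 1) = m + 1 + j by ring, show m + 1 + (j + 1) = m + 1 + j + 1 by ring]
  push_cast
  ring

theorem altTerm_eq_zero {n k : ℕ} (h : n < k) : altTerm n k = 0 := by
  simp [altTerm, Nat.choose_eq_zero_of_lt (show 3 * n + 1 < 2 * n + 1 + k by omega)]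

theorem sum_altTerm_of_le {n N : ℕ} (h : n ≤ N) :
    ∑ k ∈ Finset.range (N + 1), altTerm n k = ∑ k ∈ Finset.range (n + 1), altTerm n k := by
  symm
  apply Finset.sum_subset
  · intro k hk; simp only [Finset.mem_range] at *; omega
  · intro k _ hk
    exact altTerm_eq_zero (by simp only [Finset.mem_range] at hk; omega)

theorem sum_altTerm_recurrence (m : ℕ) :
    ((m : ℚ) + 2) ^ 3 * ∑ k ∈ Finset.range (m + 2 + 1), altTerm (m + 2) k =
      (2 * m + 3) * (13 * (m + 1) ^ 2 + 13 * (m + 1) + 4) *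
        ∑ k ∈ Finset.range (m + 1 + 1), altTerm (m + 1) k +
      3 * (m + 1) * (3 * m + 2) * (3 * m + 4) * ∑ k ∈ Finset.range (m + 1), altTerm m k := by
  have h := sum_range_eq_of_telescope (f := fun k => ((m : ℚ) + 2) ^ 3 * altTerm (m + 2) k -
      (2 * m + 3) * (13 * (m + 1) ^ 2 + 13 * (m + 1) + 4) * altTerm (m + 1) k -
      3 * (m + 1) * (3 * m + 2) * (3 * m + 4) * altTerm m k) (H := altCert (m + 1))
    (altTerm_telescope_zero m) (altTerm_telescope_succ m)
    (m + 2)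
  rw [Finset.sum_sub_distrib, Finset.sum_sub_distrib, ← Finset.mul_sum, ← Finset.mul_sum,
    ← Finset.mul_sum, sum_altTerm_of_le (show m + 1 ≤ m + 2 by omega),
    sum_altTerm_of_le (show m ≤ m + 2 by omega)] at h
  have h0 : altCert (m + 1) (m + 2) = 0 := by
    simp [altCert, Nat.choose_eq_zero_of_lt
      (show 3 * (m + 1) + 3 < 2 * (m + 1) + 3 + (m + 2) by omega)]
  rw [h0] at h
  linarith

/-- Both sides satisfy the same recurrence, with nonzero leading coefficient `(m + 2)³`, and agree
at `0` and `1`. -/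
theorem aperyNat_eq_sum_altTerm (n : ℕ) :
    (aperyNat n : ℚ) = ∑ k ∈ Finset.range (n + 1), altTerm n k := by
  induction n using Nat.twoStepInduction with
  | zero => simp [aperyNat, altTerm]
  | one =>
    simp [aperyNat, altTerm, Finset.sum_range_succ, Nat.choose]
    norm_num
  | more m ih ih' =>
    have h1 := aperyNat_recurrence_rat m
    have h2 := sum_altTerm_recurrence m
    rw [← ih, ← ih', ← h1] at h2
    exact (mul_left_cancel₀ (by positivity) h2).symm

theorem aperyNat_eq_alternating_sum (n : ℕ) :
    aperyNat n = ∑ k ∈ Finset.range (n + 1),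
      (-1 : ℤ) ^ (n - k) * ((3 * n + 1).choose (n - k) : ℤ) * ((n + k).choose n : ℤ) ^ 3 := by
  have h := aperyNat_eq_sum_altTerm n
  have h' : ∑ k ∈ Finset.range (n + 1), altTerm n k = ((∑ k ∈ Finset.range (n + 1),
      (-1 : ℤ) ^ (n - k) * ((3 * n + 1).choose (n - k) : ℤ) * ((n + k).choose n : ℤ) ^ 3 : ℤ) : ℚ) := by
    push_cast
    refine Finset.sum_congr rfl fun k hk => ?_
    have hk' : k ≤ n := by simp only [Finset.mem_range] at hk; omega
    obtain ⟨d, rfl⟩ := Nat.exists_eq_add_of_le hk'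
    simp only [altTerm]
    -- With `n = k + d`, symmetry of binomials replaces the lower index `n - k` by `2n + 1 + k`, and
    -- the signs agree because `n + k = d + 2k`.
    rw [Nat.add_sub_cancel_left, ← Nat.choose_symm (show d ≤ 3 * (k + d) + 1 by omega),
      show 3 * (k + d) + 1 - d = 2 * (k + d) + 1 + k by omega,
      show k + d + k = d + 2 * k by ring, pow_add, pow_mul]
    simp
  rw [h'] at h
  exact_mod_cast h

theorem aperyNat_recurrence (m : ℕ) :
    ((m : ℤ) + 2) ^ 3 * aperyNat (m + 2) =
      (2 * m + 3) * (13 * (m + 1) ^ 2 + 13 * (m + 1) + 4) * aperyNat (m + 1) +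
      3 * (m + 1) * (3 * m + 2) * (3 * m + 4) * aperyNat m := by
  exact_mod_cast aperyNat_recurrence_rat m

theorem apery_natCast (n : ℕ) : apery (n : ℤ) = aperyNat n := rfl

theorem apery_neg_one : apery (-1) = 0 := rfl

theorem aperyNat_zero : aperyNat 0 = 1 := by decide

theorem aperyNat_one : aperyNat 1 = 4 := by decide

theorem apery_recurrence (n : ℕ) :
    ((n : ℤ) + 1) ^ 3 * apery ((n : ℤ) + 1) =
      (2 * (n : ℤ) + 1) * (13 * (n : ℤ) ^ 2 + 13 * (n : ℤ) + 4) * apery (n : ℤ) +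
        3 * (n : ℤ) * (3 * (n : ℤ) - 1) * (3 * (n : ℤ) + 1) * apery ((n : ℤ) - 1) := by
  rcases n with _ | m
  · have h0 : apery 0 = 1 := aperyNat_zero
    have h1 : apery 1 = 4 := aperyNat_one
    simp [h0, h1]
  · have e1 : ((m + 1 : ℕ) : ℤ) + 1 = ((m + 2 : ℕ) : ℤ) := by push_cast; ring
    have e2 : ((m + 1 : ℕ) : ℤ) - 1 = (m : ℤ) := by push_cast; ring
    rw [e1, e2, apery_natCast, apery_natCast, apery_natCast]
    have h := aperyNat_recurrence m
    push_cast
    linear_combination h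

/-! ### Coefficients of the Legendre polynomials and of their squares -/

theorem choose_mul_choose_add_succ_left (n k : ℕ) :
    ((n : ℚ) + 1 - k) * (((n + 1).choose k : ℚ) * ((n + 1 + k).choose (n + 1) : ℚ)) =
      (n + 1 + k) * ((n.choose k : ℚ) * ((n + k).choose n : ℚ)) := by
  have h1 := cast_choose_succ_left n k
  have h2 := cast_choose_succ_succ (n + k) n
  rw [show n + k + 1 = n + 1 + k by ring] at h2
  push_cast at h2
  apply mul_left_cancel₀ (show (n : ℚ) + 1 ≠ 0 by positivity)
  linear_combination (((n : ℚ) + 1) * ((n + 1 + k).choose (n + 1) : ℚ)) * h1 +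
    ((n : ℚ) + 1) * (n.choose k : ℚ) * h2

theorem choose_mul_choose_add_succ_right (n k : ℕ) :
    ((k : ℚ) + 1) ^ 2 * ((n.choose (k + 1) : ℚ) * ((n + (k + 1)).choose n : ℚ)) =
      (n - k) * (n + k + 1) * ((n.choose k : ℚ) * ((n + k).choose n : ℚ)) := by
  have h1 := cast_choose_succ_right n k
  have h2 := cast_choose_succ_left (n + k) n
  rw [show n + k + 1 = n + (k + 1) by ring] at h2
  push_cast at h2
  linear_combination (((k : ℚ) + 1) * ((n + (k + 1)).choose n : ℚ)) * h1 +
    ((n : ℚ) - k) * (n.choose k : ℚ) * h2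

/-- `C(n,k) C(n+k,n)`, the coefficient of `((y - 1) / 2) ^ k` in `P_n(y)`. -/
def legendreCoeff (n k : ℕ) : ℂ := (n.choose k : ℂ) * ((n + k).choose n : ℂ)

theorem legendreCoeff_eq_zero {n k : ℕ} (h : n < k) : legendreCoeff n k = 0 := by
  simp [legendreCoeff, Nat.choose_eq_zero_of_lt h]

theorem legendreCoeff_zero_right (n : ℕ) : legendreCoeff n 0 = 1 := by
  simp [legendreCoeff]

theorem legendreCoeff_succ_left (n k : ℕ) :
    ((n : ℂ) + 1 - k) * legendreCoeff (n + 1) k = (n + 1 + k) * legendreCoeff n k := by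
  have h := congrArg (Rat.cast : ℚ → ℂ) (choose_mul_choose_add_succ_left n k)
  push_cast at h
  exact h

theorem legendreCoeff_succ_right (n k : ℕ) :
    ((k : ℂ) + 1) ^ 2 * legendreCoeff n (k + 1) = (n - k) * (n + k + 1) * legendreCoeff n k := by
  have h := congrArg (Rat.cast : ℚ → ℂ) (choose_mul_choose_add_succ_right n k)
  push_cast at h
  exact h

theorem legendreCoeff_recurrence_zero (n : ℕ) :
    ((n : ℂ) + 2) * legendreCoeff (n + 2) 0 =
      (2 * n + 3) * legendreCoeff (n + 1) 0 - (n + 1) * legendreCoeff n 0 := by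
  simp only [legendreCoeff_zero_right]; ring

/-- This is Bonnet's recurrence read off at `s ^ (k + 1)`, with `y = 1 + 2s`; all four coefficients
are polynomial multiples of a single `q`. -/
theorem legendreCoeff_recurrence_succ (n k : ℕ) :
    ((n : ℂ) + 2) * legendreCoeff (n + 2) (k + 1) =
      (2 * n + 3) * (legendreCoeff (n + 1) (k + 1) + 2 * legendreCoeff (n + 1) k) -
        (n + 1) * legendreCoeff n (k + 1) := by
  have hk : (k : ℂ) + 1 ≠ 0 := by exact_mod_cast Nat.succ_ne_zero k
  have hn2 : (n : ℂ) + k + 2 ≠ 0 := by exact_mod_cast Nat.succ_ne_zero (n + k + 1)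
  have hn3 : (n : ℂ) + k + 3 ≠ 0 := by exact_mod_cast Nat.succ_ne_zero (n + k + 2)
  obtain ⟨q, hq⟩ : ∃ q, legendreCoeff (n + 1) k = (k + 1) ^ 2 * q :=
    ⟨legendreCoeff (n + 1) k / (k + 1) ^ 2, by field_simp⟩
  have h1 := legendreCoeff_succ_right (n + 1) k
  have e1 : legendreCoeff (n + 1) (k + 1) = (n + 1 - k) * (n + k + 2) * q := by
    apply mul_left_cancel₀ (pow_ne_zero 2 hk)
    rw [hq] at h1; push_cast at h1
    linear_combination h1
  have h0 := legendreCoeff_succ_left n (k + 1)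
  have e0 : legendreCoeff n (k + 1) = (n + 1 - k) * (n - k) * q := by
    apply mul_left_cancel₀ hn2
    rw [e1] at h0; push_cast at h0
    linear_combination -h0
  have h2 := legendreCoeff_succ_left (n + 1) k
  have h3 := legendreCoeff_succ_right (n + 2) k
  have e2 : legendreCoeff (n + 2) (k + 1) = (n + k + 3) * (n + k + 2) * q := by
    apply mul_left_cancel₀ (pow_ne_zero 2 hk)
    rw [hq] at h2; push_cast at h2 h3
    linear_combination h3 + (n + k + 3) * h2
  rw [e0, e1, e2, hq]; ring

/-- The Legendre function as a polynomial in `s = (y - 1) / 2`. -/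
def legendreSum (n : ℕ) (s : ℂ) : ℂ := ∑ k ∈ Finset.range (n + 1), legendreCoeff n k * s ^ k

theorem sum_range_extend {R : Type*} [Ring R] {c : ℕ → R} {n N : ℕ} (hc : ∀ k, n < k → c k = 0)
    (h : n ≤ N) (s : R) :
    ∑ k ∈ Finset.range (N + 1), c k * s ^ k = ∑ k ∈ Finset.range (n + 1), c k * s ^ k := by
  symm
  apply Finset.sum_subset
  · intro k hk; simp only [Finset.mem_range] at *; omega
  · intro k _ hk
    rw [hc k (by simp only [Finset.mem_range] at hk; omega), zero_mul]

theorem legendreSum_zero (s : ℂ) : legendreSum 0 s = 1 := by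
  simp [legendreSum, legendreCoeff]

theorem legendreSum_one (s : ℂ) : legendreSum 1 s = 1 + 2 * s := by
  norm_num [legendreSum, legendreCoeff, Finset.sum_range_succ]

theorem legendreSum_recurrence (n : ℕ) (s : ℂ) :
    ((n : ℂ) + 2) * legendreSum (n + 2) s =
      (2 * n + 3) * (1 + 2 * s) * legendreSum (n + 1) s - (n + 1) * legendreSum n s := by
  have e1 : legendreSum (n + 1) s = ∑ k ∈ Finset.range (n + 2 + 1), legendreCoeff (n + 1) k * s ^ k :=
    (sum_range_extend (fun k hk => legendreCoeff_eq_zero hk) (by omega) s).symm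
  have e0 : legendreSum n s = ∑ k ∈ Finset.range (n + 2 + 1), legendreCoeff n k * s ^ k :=
    (sum_range_extend (fun k hk => legendreCoeff_eq_zero hk) (by omega) s).symm
  have e1' : (2 * (n : ℂ) + 3) * (1 + 2 * s) * legendreSum (n + 1) s =
      (2 * n + 3) * legendreSum (n + 1) s + 2 * (2 * n + 3) * s * legendreSum (n + 1) s := by ring
  rw [e1']
  nth_rewrite 1 [e1]
  rw [e0, legendreSum, legendreSum, Finset.sum_range_succ', Finset.sum_range_succ' _ (n + 2),
    Finset.sum_range_succ' _ (n + 2)]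
  have h0 := legendreCoeff_recurrence_zero n
  have hs : ((n : ℂ) + 2) * ∑ k ∈ Finset.range (n + 2), legendreCoeff (n + 2) (k + 1) * s ^ (k + 1) =
      (2 * n + 3) * ∑ k ∈ Finset.range (n + 2), legendreCoeff (n + 1) (k + 1) * s ^ (k + 1) +
      2 * (2 * n + 3) * s * ∑ k ∈ Finset.range (n + 1 + 1), legendreCoeff (n + 1) k * s ^ k -
      (n + 1) * ∑ k ∈ Finset.range (n + 2), legendreCoeff n (k + 1) * s ^ (k + 1) := by
    simp only [Finset.mul_sum]
    rw [← Finset.sum_add_distrib, ← Finset.sum_sub_distrib]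
    refine Finset.sum_congr rfl fun k _ => ?_
    linear_combination s ^ (k + 1) * legendreCoeff_recurrence_succ n k
  linear_combination hs + h0

/-- Identifies the hypergeometric coefficients: `(-n)_k` supplies the sign and the truncation at `k
= n`. -/
theorem ascPochhammer_eval_neg (n k : ℕ) :
    (ascPochhammer ℂ k).eval (-(n : ℂ)) * ((ascPochhammer ℂ k).eval ((n : ℂ) + 1)) =
      (-1) ^ k * legendreCoeff n k * (k.factorial : ℂ) ^ 2 := by
  induction k with
  | zero => simp [legendreCoeff]
  | succ k ih =>
    rw [ascPochhammer_succ_eval, ascPochhammer_succ_eval, Nat.factorial_succ]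
    push_cast
    linear_combination (-(n : ℂ) + k) * (n + 1 + k) * ih +
      (-1) ^ k * (k.factorial : ℂ) ^ 2 * legendreCoeff_succ_right n k

theorem legendreP_eq_legendreSum (n : ℕ) (y : ℂ) :
    legendreP n y = legendreSum n ((y - 1) / 2) := by
  have key (k : ℕ) : ((k.factorial : ℂ)⁻¹ * (ascPochhammer ℂ k).eval (-(n : ℂ)) *
      (ascPochhammer ℂ k).eval ((n : ℂ) + 1) * ((ascPochhammer ℂ k).eval (1 : ℂ))⁻¹) *
      ((1 - y) / 2) ^ k = legendreCoeff n k * ((y - 1) / 2) ^ k := by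
    have hk : (k.factorial : ℂ) ≠ 0 := by exact_mod_cast Nat.factorial_ne_zero k
    have h := ascPochhammer_eval_neg n k
    rw [ascPochhammer_eval_one, show (1 - y) / 2 = -1 * ((y - 1) / 2) by ring, mul_pow]
    have h1 : ((-1 : ℂ) ^ k) * (-1) ^ k = 1 := by rw [← mul_pow]; norm_num
    field_simp
    linear_combination ((y - 1) / 2) ^ k * ((-1 : ℂ) ^ k * h +
      legendreCoeff n k * (k.factorial : ℂ) ^ 2 * h1)
  rw [legendreP, ordinaryHypergeometric_eq_tsum, legendreSum]
  simp only [smul_eq_mul, key]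
  apply tsum_eq_sum
  intro k hk
  rw [legendreCoeff_eq_zero (by simp only [Finset.mem_range] at hk; omega), zero_mul]

/-! ### Squares and products of consecutive Legendre polynomials as polynomials in `(y² - 1) / 4`.
-/

/-- `C(n,k) C(n+k,n) C(2k,k)`. -/
def sqCoeff (n k : ℕ) : ℂ := legendreCoeff n k * ((2 * k).choose k : ℂ)

/-- The coefficients of `P_n(y) P_{n-1}(y) / y` as a polynomial in `(y² - 1) / 4`. -/
noncomputable def mixedCoeff (n k : ℕ) : ℂ := ((n : ℂ) - k) / n * sqCoeff n k

/-- The coefficients of `P_{n-1}(y)²` as a polynomial in `(y² - 1) / 4`, zero for `n = 0`. -/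
noncomputable def prevCoeff (n k : ℕ) : ℂ := ((n : ℂ) - k) / (n + k) * sqCoeff n k

theorem sqCoeff_eq_zero {n k : ℕ} (h : n < k) : sqCoeff n k = 0 := by
  simp [sqCoeff, legendreCoeff_eq_zero h]

theorem sqCoeff_zero_right (n : ℕ) : sqCoeff n 0 = 1 := by simp [sqCoeff, legendreCoeff]

theorem sqCoeff_succ_left (n k : ℕ) :
    ((n : ℂ) + 1 - k) * sqCoeff (n + 1) k = (n + 1 + k) * sqCoeff n k := by
  simp only [sqCoeff]
  linear_combination ((2 * k).choose k : ℂ) * legendreCoeff_succ_left n k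

theorem sqCoeff_succ_right (n k : ℕ) :
    ((k : ℂ) + 1) ^ 3 * sqCoeff n (k + 1) =
      2 * (2 * k + 1) * (n - k) * (n + k + 1) * sqCoeff n k := by
  have h := legendreCoeff_succ_right n k
  have h2 : ((k : ℂ) + 1) * ((2 * (k + 1)).choose (k + 1) : ℂ) =
      2 * (2 * k + 1) * ((2 * k).choose k : ℂ) := by
    exact_mod_cast Nat.succ_mul_centralBinom_succ k
  simp only [sqCoeff]
  linear_combination ((k : ℂ) + 1) * ((2 * (k + 1)).choose (k + 1) : ℂ) * h +
    (n - k) * (n + k + 1) * legendreCoeff n k * h2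

/-- The denominator-free relation also survives at `n = 0`, where the definition divides by zero;
the later identities use this form. -/
theorem natCast_mul_mixedCoeff (n k : ℕ) : (n : ℂ) * mixedCoeff n k = (n - k) * sqCoeff n k := by
  rcases n with _ | n
  · rcases k with _ | k
    · simp
    · simp [sqCoeff_eq_zero (Nat.succ_pos k)]
  · have : ((n + 1 : ℕ) : ℂ) ≠ 0 := by exact_mod_cast Nat.succ_ne_zero n
    simp only [mixedCoeff]; field_simp

theorem add_mul_prevCoeff (n k : ℕ) :
    ((n : ℂ) + k) * prevCoeff n k = (n - k) * sqCoeff n k := by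
  rcases Nat.eq_zero_or_pos (n + k) with h | h
  · obtain ⟨rfl, rfl⟩ : n = 0 ∧ k = 0 := by omega
    simp
  · have : (n : ℂ) + k ≠ 0 := by exact_mod_cast h.ne'
    simp only [prevCoeff]; field_simp

theorem mixedCoeff_zero_left (k : ℕ) : mixedCoeff 0 k = 0 := by simp [mixedCoeff]

theorem prevCoeff_zero_left (k : ℕ) : prevCoeff 0 k = 0 := by
  rcases k with _ | k
  · simp [prevCoeff]
  · simp [prevCoeff, sqCoeff_eq_zero (Nat.succ_pos k)]

theorem mixedCoeff_eq_zero {n k : ℕ} (h : n ≤ k) : mixedCoeff n k = 0 := by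
  rcases h.eq_or_lt with rfl | h
  · simp [mixedCoeff]
  · simp [mixedCoeff, sqCoeff_eq_zero h]

theorem prevCoeff_eq_zero {n k : ℕ} (h : n < k) : prevCoeff n k = 0 := by
  simp [prevCoeff, sqCoeff_eq_zero h]

theorem prevCoeff_succ (n k : ℕ) : prevCoeff (n + 1) k = sqCoeff n k := by
  have h0 : (n : ℂ) + 1 + k ≠ 0 := by
    exact_mod_cast (show n + 1 + k ≠ 0 by omega)
  have h := add_mul_prevCoeff (n + 1) k
  push_cast at h
  rw [sqCoeff_succ_left] at h
  exact mul_left_cancel₀ h0 h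

theorem mixedCoeff_succ (n k : ℕ) :
    ((n : ℂ) + 1) * mixedCoeff (n + 1) k = (2 * n + 1) * sqCoeff n k - n * mixedCoeff n k := by
  have h := natCast_mul_mixedCoeff (n + 1) k
  have h' := natCast_mul_mixedCoeff n k
  have h'' := sqCoeff_succ_left n k
  push_cast at h
  linear_combination h + h' + h''

/-- The coefficient form of squaring `(n + 1) P_{n+1} = (2n + 1) y P_n - n P_{n-1}`, where `y² = 1 +
4x` produces the shifted terms with factor `4`. -/
theorem sqCoeff_shift_succ (n k : ℕ) :
    ((n : ℂ) + 1) ^ 2 * sqCoeff (n + 1) (k + 1) =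
      (2 * n + 1) ^ 2 * (sqCoeff n (k + 1) + 4 * sqCoeff n k) -
        2 * n * (2 * n + 1) * (mixedCoeff n (k + 1) + 4 * mixedCoeff n k) +
        n ^ 2 * prevCoeff n (k + 1) := by
  have hk : (k : ℂ) + 1 ≠ 0 := by exact_mod_cast Nat.succ_ne_zero k
  have hn1 : (n : ℂ) + k + 1 ≠ 0 := by exact_mod_cast Nat.succ_ne_zero (n + k)
  obtain ⟨q, hq⟩ : ∃ q, sqCoeff n k = (k + 1) ^ 3 * q :=
    ⟨sqCoeff n k / (k + 1) ^ 3, by field_simp⟩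
  have h1 := sqCoeff_succ_right n k
  have e1 : sqCoeff n (k + 1) = 2 * (2 * k + 1) * (n - k) * (n + k + 1) * q := by
    apply mul_left_cancel₀ (pow_ne_zero 3 hk)
    rw [hq] at h1; linear_combination h1
  have h2 := sqCoeff_succ_left n k
  have h3 := sqCoeff_succ_right (n + 1) k
  have e2 : sqCoeff (n + 1) (k + 1) = 2 * (2 * k + 1) * (n + k + 2) * (n + 1 + k) * q := by
    apply mul_left_cancel₀ (pow_ne_zero 3 hk)
    rw [hq] at h2; push_cast at h3
    linear_combination h3 + 2 * (2 * k + 1) * (n + k + 2) * h2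
  have h4 := natCast_mul_mixedCoeff n k
  have h5 := natCast_mul_mixedCoeff n (k + 1)
  have h6 := add_mul_prevCoeff n (k + 1)
  have e6 : prevCoeff n (k + 1) = 2 * (2 * k + 1) * (n - k) * (n - k - 1) * q := by
    apply mul_left_cancel₀ hn1
    rw [e1] at h6; push_cast at h6; linear_combination h6
  rw [e1] at h5
  rw [hq] at h4
  rw [e2, e1, hq, e6]
  push_cast at h5
  linear_combination 2 * (2 * n + 1) * (h5 + 4 * h4)

theorem sqCoeff_shift_zero (n : ℕ) :
    ((n : ℂ) + 1) ^ 2 * sqCoeff (n + 1) 0 =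
      (2 * n + 1) ^ 2 * sqCoeff n 0 - 2 * n * (2 * n + 1) * mixedCoeff n 0 + n ^ 2 * prevCoeff n 0 := by
  have h1 := natCast_mul_mixedCoeff n 0
  have h2 : (n : ℂ) ^ 2 * prevCoeff n 0 = n ^ 2 := by
    have := add_mul_prevCoeff n 0
    simp only [sqCoeff_zero_right] at this
    push_cast at this; linear_combination n * this
  rw [h2, sqCoeff_zero_right, sqCoeff_zero_right]
  rw [sqCoeff_zero_right] at h1
  push_cast at h1
  linear_combination 2 * (2 * n + 1) * h1

theorem mixedCoeff_euler_zero (n : ℕ) : (n : ℂ) * (sqCoeff n 0 - prevCoeff n 0) = 0 := by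
  have := add_mul_prevCoeff n 0
  push_cast at this; linear_combination -this

/-- The coefficient form of the formula for `(1 + 4x) θ (P_n P_{n-1} / y)`. -/
theorem mixedCoeff_euler_succ (n k : ℕ) :
    ((k : ℂ) + 1) * mixedCoeff n (k + 1) + (4 * k + 2) * mixedCoeff n k =
      n / 2 * (sqCoeff n (k + 1) - prevCoeff n (k + 1)) := by
  rcases n with _ | n
  · simp [mixedCoeff_zero_left]
  have hn : ((n + 1 : ℕ) : ℂ) ≠ 0 := by exact_mod_cast Nat.succ_ne_zero n
  generalize n + 1 = n at *
  have hk : (k : ℂ) + 1 ≠ 0 := by exact_mod_cast Nat.succ_ne_zero k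
  have hn1 : (n : ℂ) + k + 1 ≠ 0 := by exact_mod_cast Nat.succ_ne_zero (n + k)
  obtain ⟨q, hq⟩ : ∃ q, sqCoeff n k = (k + 1) ^ 3 * q :=
    ⟨sqCoeff n k / (k + 1) ^ 3, by field_simp⟩
  have h1 := sqCoeff_succ_right n k
  have e1 : sqCoeff n (k + 1) = 2 * (2 * k + 1) * (n - k) * (n + k + 1) * q := by
    apply mul_left_cancel₀ (pow_ne_zero 3 hk)
    rw [hq] at h1; linear_combination h1
  have h4 := natCast_mul_mixedCoeff n k
  have h5 := natCast_mul_mixedCoeff n (k + 1)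
  have h6 := add_mul_prevCoeff n (k + 1)
  have e6 : prevCoeff n (k + 1) = 2 * (2 * k + 1) * (n - k) * (n - k - 1) * q := by
    apply mul_left_cancel₀ hn1
    rw [e1] at h6; push_cast at h6; linear_combination h6
  rw [e1] at h5
  rw [hq] at h4
  rw [e1, e6]
  push_cast at h5
  apply mul_left_cancel₀ hn
  linear_combination (k + 1) * h5 + (4 * k + 2) * h4

/-- `P_n(y) P_{n-1}(y) / y` in terms of `x = (y² - 1) / 4`. -/
noncomputable def mixedSum (n : ℕ) (x : ℂ) : ℂ := ∑ k ∈ Finset.range (n + 1), mixedCoeff n k * x ^ k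

/-- `P_{n-1}(y)²` in terms of `x = (y² - 1) / 4`, and zero for `n = 0`. -/
noncomputable def prevSum (n : ℕ) (x : ℂ) : ℂ := ∑ k ∈ Finset.range (n + 1), prevCoeff n k * x ^ k

theorem innerSum_eq (n : ℕ) (x : ℂ) :
    innerSum n x = ∑ k ∈ Finset.range (n + 1), sqCoeff n k * x ^ k := rfl

theorem innerSum_zero (x : ℂ) : innerSum 0 x = 1 := by simp [innerSum]

theorem mixedSum_zero (x : ℂ) : mixedSum 0 x = 0 := by simp [mixedSum, mixedCoeff_zero_left]

theorem prevSum_succ (n : ℕ) (x : ℂ) : prevSum (n + 1) x = innerSum n x := by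
  simp only [prevSum, innerSum_eq, prevCoeff_succ]
  exact sum_range_extend (fun k hk => sqCoeff_eq_zero hk) (Nat.le_succ n) x

theorem mixedSum_succ (n : ℕ) (x : ℂ) :
    ((n : ℂ) + 1) * mixedSum (n + 1) x = (2 * n + 1) * innerSum n x - n * mixedSum n x := by
  have e1 := sum_range_extend (fun k (hk : n < k) => sqCoeff_eq_zero hk) (Nat.le_succ n) x
  have e2 := sum_range_extend (fun k (hk : n < k) => mixedCoeff_eq_zero hk.le) (Nat.le_succ n) x
  rw [innerSum_eq, mixedSum, mixedSum, ← e1, ← e2, Finset.mul_sum, Finset.mul_sum, Finset.mul_sum,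
    ← Finset.sum_sub_distrib]
  refine Finset.sum_congr rfl fun k _ => ?_
  linear_combination x ^ k * mixedCoeff_succ n k

theorem innerSum_succ (n : ℕ) (x : ℂ) :
    ((n : ℂ) + 1) ^ 2 * innerSum (n + 1) x =
      (2 * n + 1) ^ 2 * (1 + 4 * x) * innerSum n x -
        2 * n * (2 * n + 1) * (1 + 4 * x) * mixedSum n x + n ^ 2 * prevSum n x := by
  have e1 := sum_range_extend (fun k (hk : n < k) => sqCoeff_eq_zero hk) (Nat.le_succ n) x
  have e2 := sum_range_extend (fun k (hk : n < k) => mixedCoeff_eq_zero hk.le) (Nat.le_succ n) x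
  have e3 := sum_range_extend (fun k (hk : n < k) => prevCoeff_eq_zero hk) (Nat.le_succ n) x
  have split : (2 * (n : ℂ) + 1) ^ 2 * (1 + 4 * x) * innerSum n x -
      2 * n * (2 * n + 1) * (1 + 4 * x) * mixedSum n x + n ^ 2 * prevSum n x =
      ((2 * n + 1) ^ 2 * innerSum n x - 2 * n * (2 * n + 1) * mixedSum n x + n ^ 2 * prevSum n x) +
      4 * x * ((2 * n + 1) ^ 2 * innerSum n x - 2 * n * (2 * n + 1) * mixedSum n x) := by ring
  have low : (2 * (n : ℂ) + 1) ^ 2 * innerSum n x - 2 * n * (2 * n + 1) * mixedSum n x +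
      n ^ 2 * prevSum n x = ∑ k ∈ Finset.range (n + 1 + 1), ((2 * (n : ℂ) + 1) ^ 2 * sqCoeff n k -
        2 * n * (2 * n + 1) * mixedCoeff n k + n ^ 2 * prevCoeff n k) * x ^ k := by
    rw [innerSum_eq, mixedSum, prevSum, ← e1, ← e2, ← e3, Finset.mul_sum, Finset.mul_sum,
      Finset.mul_sum, ← Finset.sum_sub_distrib, ← Finset.sum_add_distrib]
    exact Finset.sum_congr rfl fun k _ => by ring
  have high : 4 * x * ((2 * (n : ℂ) + 1) ^ 2 * innerSum n x - 2 * n * (2 * n + 1) * mixedSum n x) =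
      ∑ k ∈ Finset.range (n + 1), 4 * ((2 * (n : ℂ) + 1) ^ 2 * sqCoeff n k -
        2 * n * (2 * n + 1) * mixedCoeff n k) * x ^ (k + 1) := by
    rw [innerSum_eq, mixedSum, Finset.mul_sum, Finset.mul_sum, ← Finset.sum_sub_distrib,
      Finset.mul_sum]
    exact Finset.sum_congr rfl fun k _ => by ring
  rw [split, low, high, innerSum_eq, Finset.mul_sum, Finset.sum_range_succ',
    Finset.sum_range_succ' _ (n + 1), add_right_comm, ← Finset.sum_add_distrib]
  congr 1
  · refine Finset.sum_congr rfl fun k _ => ?_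
    linear_combination x ^ (k + 1) * sqCoeff_shift_succ n k
  · linear_combination x ^ 0 * sqCoeff_shift_zero n

/-- The square of a Legendre polynomial and the product of two consecutive ones. -/
theorem legendreSum_products (n : ℕ) {y x : ℂ} (h : y ^ 2 = 1 + 4 * x) :
    legendreSum n ((y - 1) / 2) ^ 2 = innerSum n x ∧
      legendreSum (n + 1) ((y - 1) / 2) ^ 2 = innerSum (n + 1) x ∧
      legendreSum (n + 1) ((y - 1) / 2) * legendreSum n ((y - 1) / 2) = y * mixedSum (n + 1) x := by
  induction n with
  | zero =>
    have h1 := mixedSum_succ 0 x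
    have h2 := innerSum_succ 0 x
    simp only [Nat.cast_zero, innerSum_zero, mixedSum_zero] at h1 h2
    refine ⟨by simp [legendreSum_zero, innerSum_zero], ?_, ?_⟩
    · rw [legendreSum_one]; linear_combination h - h2
    · rw [legendreSum_one, legendreSum_zero]; linear_combination -y * h1
  | succ n ih =>
    obtain ⟨ih0, ih1, ih2⟩ := ih
    have hn2 : (n : ℂ) + 2 ≠ 0 := by exact_mod_cast Nat.succ_ne_zero (n + 1)
    have hA := innerSum_succ (n + 1) x
    have hB := mixedSum_succ (n + 1) x
    have hP := legendreSum_recurrence n ((y - 1) / 2)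
    rw [prevSum_succ] at hA
    push_cast at hA hB
    generalize legendreSum (n + 1 + 1) ((y - 1) / 2) = p2 at *
    generalize legendreSum (n + 1) ((y - 1) / 2) = p1 at *
    generalize legendreSum n ((y - 1) / 2) = p0 at *
    have hP' : ((n : ℂ) + 2) * p2 = (2 * n + 3) * y * p1 - (n + 1) * p0 := by
      linear_combination hP
    refine ⟨ih1, ?_, ?_⟩
    · apply mul_left_cancel₀ (pow_ne_zero 2 hn2)
      -- The multiplier of `hP'` is the sum of its two sides, so that the recurrence enters squared.
      linear_combination (((n : ℂ) + 2) * p2 + ((2 * n + 3) * y * p1 - (n + 1) * p0)) * hP' - hA +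
        (2 * n + 3) ^ 2 * (y ^ 2 * ih1 + innerSum (n + 1) x * h) -
        2 * (n + 1) * (2 * n + 3) * (y * ih2 + mixedSum (n + 1) x * h) + (n + 1) ^ 2 * ih0
    · apply mul_left_cancel₀ hn2
      linear_combination p1 * hP' - y * hB - (n + 1) * ih2 + (2 * n + 3) * y * ih1

theorem legendreP_sq (n : ℕ) {y x : ℂ} (h : y ^ 2 = 1 + 4 * x) :
    legendreP n y ^ 2 = innerSum n x := by
  rw [legendreP_eq_legendreSum]
  exact (legendreSum_products n h).1

/-! ### Euler-type derivations `v c(v) d/dv` -/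

/-- The derivation `v c(v) d/dv`. -/
noncomputable def eulerD (c f : ℂ → ℂ) : ℂ → ℂ := fun v => v * c v * deriv f v

/-- `f` is differentiable at `v` and `v c(v) f'(v)` equals `f'`. -/
def HasEuler (c f : ℂ → ℂ) (f' v : ℂ) : Prop := ∃ d, HasDerivAt f d v ∧ f' = v * c v * d

namespace HasEuler

variable {c f g : ℂ → ℂ} {f' g' v : ℂ}

theorem const (a : ℂ) : HasEuler c (fun _ => a) 0 v := ⟨0, hasDerivAt_const v a, by ring⟩

theorem id : HasEuler c (fun w => w) (v * c v) v := ⟨1, hasDerivAt_id v, by ring⟩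

theorem add (hf : HasEuler c f f' v) (hg : HasEuler c g g' v) :
    HasEuler c (fun w => f w + g w) (f' + g') v := by
  obtain ⟨d, hd, rfl⟩ := hf
  obtain ⟨e, he, rfl⟩ := hg
  exact ⟨d + e, hd.add he, by ring⟩

theorem sub (hf : HasEuler c f f' v) (hg : HasEuler c g g' v) :
    HasEuler c (fun w => f w - g w) (f' - g') v := by
  obtain ⟨d, hd, rfl⟩ := hf
  obtain ⟨e, he, rfl⟩ := hg
  exact ⟨d - e, hd.sub he, by ring⟩

theorem mul (hf : HasEuler c f f' v) (hg : HasEuler c g g' v) :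
    HasEuler c (fun w => f w * g w) (f' * g v + f v * g') v := by
  obtain ⟨d, hd, rfl⟩ := hf
  obtain ⟨e, he, rfl⟩ := hg
  exact ⟨d * g v + f v * e, hd.mul he, by ring⟩

theorem const_mul (a : ℂ) (hf : HasEuler c f f' v) : HasEuler c (fun w => a * f w) (a * f') v := by
  obtain ⟨d, hd, rfl⟩ := hf
  exact ⟨a * d, hd.const_mul a, by ring⟩

theorem pow (n : ℕ) (hf : HasEuler c f f' v) :
    HasEuler c (fun w => f w ^ n) (n * f v ^ (n - 1) * f') v := by
  obtain ⟨d, hd, rfl⟩ := hf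
  exact ⟨n * f v ^ (n - 1) * d, hd.fun_pow n, by ring⟩

theorem inv (hf : HasEuler c f f' v) (h0 : f v ≠ 0) :
    HasEuler c (fun w => (f w)⁻¹) (-f' * (f v)⁻¹ ^ 2) v := by
  obtain ⟨d, hd, rfl⟩ := hf
  exact ⟨-d / f v ^ 2, hd.fun_inv h0, by field_simp⟩

theorem sum {ι : Type*} {s : Finset ι} {f : ι → ℂ → ℂ} {f' : ι → ℂ}
    (h : ∀ i ∈ s, HasEuler c (f i) (f' i) v) :
    HasEuler c (fun w => ∑ i ∈ s, f i w) (∑ i ∈ s, f' i) v := by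
  classical
  induction s using Finset.induction_on with
  | empty => simpa using const (c := c) (v := v) 0
  | insert a s ha ih =>
    simp only [Finset.sum_insert ha]
    exact (h a (Finset.mem_insert_self a s)).add
      (ih fun i hi => h i (Finset.mem_insert_of_mem hi))

theorem congr_val {f'' : ℂ} (hf : HasEuler c f f' v) (h : f' = f'') : HasEuler c f f'' v := h ▸ hf

theorem congr_fun (hf : HasEuler c f f' v) (h : ∀ w, g w = f w) : HasEuler c g f' v := by
  rwa [show g = f from funext h]

/-- The condition on `X` says that the derivation in `v` restricts to the derivation of weight `b`
on functions of `X`; the chain rule then leaves the derivative unchanged. -/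
theorem comp {b : ℂ → ℂ} {X : ℂ → ℂ} (hf : HasEuler b f f' (X v))
    (hX : HasEuler c X (X v * b (X v)) v) : HasEuler c (fun w => f (X w)) f' v := by
  obtain ⟨d, hd, rfl⟩ := hf
  obtain ⟨e, he, hXe⟩ := hX
  exact ⟨d * e, hd.comp v he, by rw [hXe]; ring⟩

theorem eulerD_eq (hf : HasEuler c f f' v) : eulerD c f v = f' := by
  obtain ⟨d, hd, rfl⟩ := hf
  rw [eulerD, hd.deriv]

theorem differentiableAt (hf : HasEuler c f f' v) : DifferentiableAt ℂ f v := by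
  obtain ⟨d, hd, _⟩ := hf
  exact hd.differentiableAt

end HasEuler

/-- Locally uniform limits commute with `eulerD`. -/
theorem tendstoLocallyUniformlyOn_eulerD {c F : ℂ → ℂ} {U : Set ℂ} (hU : IsOpen U)
    (hc : ContinuousOn c U) {f f' : ℕ → ℂ → ℂ} (hf : ∀ N, ∀ v ∈ U, HasEuler c (f N) (f' N v) v)
    (hF : TendstoLocallyUniformlyOn f F atTop U) :
    TendstoLocallyUniformlyOn f' (eulerD c F) atTop U := by
  have hd : ∀ᶠ N in atTop, DifferentiableOn ℂ (f N) U :=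
    Eventually.of_forall fun N v hv => (hf N v hv).differentiableAt.differentiableWithinAt
  -- Weierstrass: locally uniform convergence of holomorphic functions passes to derivatives.
  have h1 := hF.deriv hd hU
  have h2 : TendstoLocallyUniformlyOn (fun (_ : ℕ) (v : ℂ) => v * c v) (fun v => v * c v) atTop U := by
    intro u hu x _
    exact ⟨U, self_mem_nhdsWithin, Eventually.of_forall fun _ y _ => refl_mem_uniformity hu⟩
  have h3 := h2.mul₀ h1 (continuousOn_id.mul hc)
    (((hF.differentiableOn hd hU).deriv hU).continuousOn)
  refine h3.congr fun N v hv => ?_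
  have := (hf N v hv).eulerD_eq
  simpa [eulerD] using this

/-- Since `c 0 = 1`, the derivation multiplies the coefficient of `v ^ n` at the origin by `n`, just
as `v d/dv` does. -/
theorem eulerD_eventuallyEq_pow_mul {c f g : ℂ → ℂ} {n : ℕ} (hc : AnalyticAt ℂ c 0) (hc0 : c 0 = 1)
    (hg : AnalyticAt ℂ g 0) (hf : f =ᶠ[𝓝 0] fun v => v ^ n * g v) :
    ∃ g₁ : ℂ → ℂ, AnalyticAt ℂ g₁ 0 ∧ g₁ 0 = n * g 0 ∧ eulerD c f =ᶠ[𝓝 0] fun v => v ^ n * g₁ v := by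
  refine ⟨fun v => c v * (n * g v + v * deriv g v), ?_, by simp [hc0], ?_⟩
  · exact hc.mul ((analyticAt_const.mul hg).add (analyticAt_id.mul hg.deriv))
  · filter_upwards [hf.eventuallyEq_nhds, hg.eventually_analyticAt] with v hv hgv
    rw [eulerD, hv.deriv_eq]
    have hd : HasDerivAt (fun v => v ^ n * g v) (n * v ^ (n - 1) * g v + v ^ n * deriv g v) v :=
      (hasDerivAt_pow n v).mul hgv.differentiableAt.hasDerivAt
    rw [hd.deriv]
    rcases n with _ | n
    · simp; ring
    · rw [Nat.add_sub_cancel]; ring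

/-- Uniqueness at a singular point with maximally unipotent local monodromy. -/
theorem eventually_eq_zero_of_euler_ode {c E q₀ q₁ q₂ q₃ : ℂ → ℂ} (hc : AnalyticAt ℂ c 0)
    (hc0 : c 0 = 1) (hE : AnalyticAt ℂ E 0) (hE0 : E 0 = 0)
    (h₀ : ContinuousAt q₀ 0) (h₁ : ContinuousAt q₁ 0) (h₂ : ContinuousAt q₂ 0)
    (h₃ : ContinuousAt q₃ 0) (v₀ : q₀ 0 = 0) (v₁ : q₁ 0 = 0) (v₂ : q₂ 0 = 0) (v₃ : q₃ 0 = 1)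
    (ode : ∀ᶠ v in 𝓝 0, q₃ v * eulerD c (eulerD c (eulerD c E)) v +
      q₂ v * eulerD c (eulerD c E) v + q₁ v * eulerD c E v + q₀ v * E v = 0) :
    ∀ᶠ v in 𝓝 0, E v = 0 := by
  by_contra hne
  -- Here `n` is the order of vanishing, positive because `E 0 = 0`.
  obtain ⟨n, g, hg, hg0, hEg⟩ := hE.exists_eventuallyEq_pow_smul_nonzero_iff.mpr hne
  simp only [sub_zero, smul_eq_mul] at hEg
  have hn : n ≠ 0 := by
    rintro rfl
    have := hEg.self_of_nhds
    simp [hE0] at this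
    exact hg0 this.symm
  obtain ⟨g₁, a₁, e₁, E₁⟩ := eulerD_eventuallyEq_pow_mul hc hc0 hg hEg
  obtain ⟨g₂, a₂, e₂, E₂⟩ := eulerD_eventuallyEq_pow_mul hc hc0 a₁ E₁
  obtain ⟨g₃, a₃, e₃, E₃⟩ := eulerD_eventuallyEq_pow_mul hc hc0 a₂ E₂
  -- The equation divided by `v ^ n`: zero off the origin, hence by continuity at it, where its
  -- value is `n³ g(0) ≠ 0`.
  set h : ℂ → ℂ := fun v => q₃ v * g₃ v + q₂ v * g₂ v + q₁ v * g₁ v + q₀ v * g v with hh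
  have hcont : ContinuousAt h 0 :=
    (((h₃.mul a₃.continuousAt).add (h₂.mul a₂.continuousAt)).add (h₁.mul a₁.continuousAt)).add
      (h₀.mul hg.continuousAt)
  have hzero : ∀ᶠ v in 𝓝[≠] (0 : ℂ), h v = 0 := by
    filter_upwards [ode.filter_mono nhdsWithin_le_nhds, E₁.filter_mono nhdsWithin_le_nhds,
      E₂.filter_mono nhdsWithin_le_nhds, E₃.filter_mono nhdsWithin_le_nhds,
      hEg.filter_mono nhdsWithin_le_nhds, self_mem_nhdsWithin] with v o x₁ x₂ x₃ x₀ hv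
    rw [x₁, x₂, x₃, x₀] at o
    have hv' : v ^ n ≠ 0 := pow_ne_zero n hv
    apply mul_left_cancel₀ hv'
    simp only [hh]
    linear_combination o
  have h00 : h 0 = 0 := by
    have t1 : Tendsto h (𝓝[≠] 0) (𝓝 (h 0)) := hcont.tendsto.mono_left nhdsWithin_le_nhds
    have t2 : Tendsto h (𝓝[≠] 0) (𝓝 0) :=
      tendsto_const_nhds.congr' (hzero.mono fun v hv => hv.symm)
    exact tendsto_nhds_unique t1 t2
  simp only [hh, v₀, v₁, v₂, v₃, e₃, e₂, e₁] at h00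
  have hn' : (n : ℂ) ≠ 0 := by exact_mod_cast hn
  have : (n : ℂ) * (n * (n * g 0)) ≠ 0 := by positivity
  apply this
  linear_combination h00

/-! ### The differential operator applied to the terms of the right-hand side -/

theorem HasEuler.pow_of_log {c f : ℂ → ℂ} {κ v : ℂ} (h : HasEuler c f (κ * f v) v) (n : ℕ) :
    HasEuler c (fun w => f w ^ n) (n * κ * f v ^ n) v := by
  refine (h.pow n).congr_val ?_
  rcases n with _ | n
  · simp
  · rw [Nat.add_sub_cancel]; ring

/-- The weight of the derivation in `v` that corresponds to `x d/dx` under `x = xParam v`. -/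
noncomputable def xWeight (v : ℂ) : ℂ := (1 + 5 * v + 8 * v ^ 2) * (1 - 8 * v ^ 2)⁻¹

/-- The third-order operator `(θ₀, θ₁, θ₂, θ₃) ↦ ∑ qᵢ(x) θᵢ` annihilating both sides. -/
def odeForm (x f₀ f₁ f₂ f₃ : ℂ) : ℂ :=
  (1 - 6 * x - 47 * x ^ 2 - 28 * x ^ 3) * f₃ + (-9 * x - 141 * x ^ 2 - 126 * x ^ 3) * f₂ +
    (-5 * x - 145 * x ^ 2 - 182 * x ^ 3) * f₁ + (-x - 51 * x ^ 2 - 84 * x ^ 3) * f₀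

theorem hasEuler_inv_one_add_four_mul {c : ℂ → ℂ} {v : ℂ} (h : 1 + 4 * v ≠ 0) :
    HasEuler c (fun w => (1 + 4 * w)⁻¹) (-(4 * (v * c v)) * (1 + 4 * v)⁻¹ ^ 2) v := by
  refine (((HasEuler.const 1).add (HasEuler.id.const_mul 4)).inv h).congr_val ?_
  ring

theorem hasEuler_inv_one_sub_eight_mul_sq {c : ℂ → ℂ} {v : ℂ} (h : 1 - 8 * v ^ 2 ≠ 0) :
    HasEuler c (fun w => (1 - 8 * w ^ 2)⁻¹) (16 * v * (v * c v) * (1 - 8 * v ^ 2)⁻¹ ^ 2) v := by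
  refine (((HasEuler.const 1).sub ((HasEuler.id.pow 2).const_mul 8)).inv h).congr_val ?_
  simp only [Nat.cast_ofNat, Nat.reduceSub, pow_one]
  generalize (1 - 8 * v ^ 2)⁻¹ = i
  ring

theorem hasEuler_quad {c : ℂ → ℂ} {v : ℂ} :
    HasEuler c (fun w => 1 + 5 * w + 8 * w ^ 2) ((5 + 16 * v) * (v * c v)) v := by
  refine (((HasEuler.const 1).add (HasEuler.id.const_mul 5)).add
    ((HasEuler.id.pow 2).const_mul 8)).congr_val ?_
  norm_num; ring

/-- `v / (1 + 4v)³`. -/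
noncomputable def tParam (v : ℂ) : ℂ := v * (1 + 4 * v)⁻¹ ^ 3

/-- `(1 + 5v + 8v²) / (1 + 4v)² · tⁿ`. -/
noncomputable def rightTerm (n : ℕ) (v : ℂ) : ℂ :=
  (1 + 5 * v + 8 * v ^ 2) * (1 + 4 * v)⁻¹ ^ 2 * tParam v ^ n

/-- Numerator of the logarithmic derivative of `rightTerm`. -/
def logNum (n v : ℂ) : ℂ := n * ((1 - 8 * v) * (1 + 5 * v + 8 * v ^ 2)) - v * (3 + 4 * v)

/-- The derivative of `logNum`. -/
def logNum' (n v : ℂ) : ℂ := n * (-3 - 64 * v - 192 * v ^ 2) - (3 + 8 * v)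

/-- The logarithmic derivative of `rightTerm`. -/
noncomputable def logDer (n v : ℂ) : ℂ := logNum n v * (1 + 4 * v)⁻¹ * (1 - 8 * v ^ 2)⁻¹

/-- The numerator of the derivative of `logDer`. -/
def logDerNum (n v : ℂ) : ℂ :=
  v * (1 + 5 * v + 8 * v ^ 2) * (logNum' n v * (1 + 4 * v - 8 * v ^ 2 - 32 * v ^ 3) -
    logNum n v * (4 - 16 * v - 96 * v ^ 2))

/-- The derivative of `logDer`. -/
noncomputable def logDer₁ (n v : ℂ) : ℂ :=
  logDerNum n v * (1 + 4 * v)⁻¹ ^ 2 * (1 - 8 * v ^ 2)⁻¹ ^ 3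

/-- The derivative of `logDerNum`. -/
def logDerNum' (n v : ℂ) : ℂ :=
  (1 + 10 * v + 24 * v ^ 2) * (logNum' n v * (1 + 4 * v - 8 * v ^ 2 - 32 * v ^ 3) -
    logNum n v * (4 - 16 * v - 96 * v ^ 2)) +
  v * (1 + 5 * v + 8 * v ^ 2) * ((n * (-64 - 384 * v) - 8) * (1 + 4 * v - 8 * v ^ 2 - 32 * v ^ 3) -
    logNum n v * (-16 - 192 * v))

/-- The second derivative of `logDer`. -/
noncomputable def logDer₂ (n v : ℂ) : ℂ :=
  v * (1 + 5 * v + 8 * v ^ 2) * (1 - 8 * v ^ 2)⁻¹ *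
    (logDerNum' n v * (1 + 4 * v)⁻¹ ^ 2 * (1 - 8 * v ^ 2)⁻¹ ^ 3 +
      logDerNum n v * (48 * v * (1 + 4 * v)⁻¹ ^ 2 * (1 - 8 * v ^ 2)⁻¹ ^ 4 -
        8 * (1 + 4 * v)⁻¹ ^ 3 * (1 - 8 * v ^ 2)⁻¹ ^ 3))

section

variable {v : ℂ}

theorem hasEuler_tParam (h4 : 1 + 4 * v ≠ 0) :
    HasEuler xWeight tParam
      ((1 - 8 * v) * (1 + 5 * v + 8 * v ^ 2) * (1 + 4 * v)⁻¹ * (1 - 8 * v ^ 2)⁻¹ * tParam v) v := by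
  refine (HasEuler.id.mul ((hasEuler_inv_one_add_four_mul h4).pow 3)).congr_val ?_
  simp only [xWeight, tParam, Nat.cast_ofNat, Nat.reduceSub]
  field_simp
  ring

theorem hasEuler_logNum {c : ℂ → ℂ} (n : ℂ) :
    HasEuler c (logNum n) (logNum' n v * (v * c v)) v := by
  refine (((((HasEuler.const 1).sub (HasEuler.id.const_mul 8)).mul hasEuler_quad).const_mul n).sub
    (HasEuler.id.mul ((HasEuler.const 3).add (HasEuler.id.const_mul 4)))).congr_val ?_
  simp only [logNum']; ring

theorem hasEuler_logNum' {c : ℂ → ℂ} (n : ℂ) :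
    HasEuler c (logNum' n) ((n * (-64 - 384 * v) - 8) * (v * c v)) v := by
  refine (((((HasEuler.const (-3)).sub (HasEuler.id.const_mul 64)).sub
    ((HasEuler.id.pow 2).const_mul 192)).const_mul n).sub
    ((HasEuler.const 3).add (HasEuler.id.const_mul 8))).congr_val ?_
  norm_num; ring

theorem hasEuler_logDer (n : ℂ) (h4 : 1 + 4 * v ≠ 0) (h8 : 1 - 8 * v ^ 2 ≠ 0) :
    HasEuler xWeight (logDer n) (logDer₁ n v) v := by
  refine (((hasEuler_logNum n).mul (hasEuler_inv_one_add_four_mul h4)).mul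
    (hasEuler_inv_one_sub_eight_mul_sq h8)).congr_val ?_
  simp only [logDer₁, logDerNum, xWeight]
  generalize logNum n v = p
  generalize logNum' n v = p'
  field_simp
  ring

theorem hasEuler_logDerNum {c : ℂ → ℂ} (n : ℂ) :
    HasEuler c (logDerNum n) (logDerNum' n v * (v * c v)) v := by
  refine ((HasEuler.id.mul hasEuler_quad).mul (((hasEuler_logNum' n).mul
    ((((HasEuler.const 1).add (HasEuler.id.const_mul 4)).sub ((HasEuler.id.pow 2).const_mul 8)).sub
      ((HasEuler.id.pow 3).const_mul 32))).sub ((hasEuler_logNum n).mul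
    (((HasEuler.const 4).sub (HasEuler.id.const_mul 16)).sub
      ((HasEuler.id.pow 2).const_mul 96))))).congr_val ?_
  simp only [logDerNum']
  generalize logNum n v = p
  generalize logNum' n v = p'
  norm_num; ring

theorem hasEuler_logDer₁ (n : ℂ) (h4 : 1 + 4 * v ≠ 0) (h8 : 1 - 8 * v ^ 2 ≠ 0) :
    HasEuler xWeight (logDer₁ n) (logDer₂ n v) v := by
  refine (((hasEuler_logDerNum n).mul ((hasEuler_inv_one_add_four_mul h4).pow 2)).mul
    ((hasEuler_inv_one_sub_eight_mul_sq h8).pow 3)).congr_val ?_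
  simp only [logDer₂, xWeight]
  generalize logDerNum n v = p
  generalize logDerNum' n v = p'
  simp only [Nat.cast_ofNat, Nat.reduceSub, pow_one]
  generalize (1 - 8 * v ^ 2)⁻¹ = i
  generalize (1 + 4 * v)⁻¹ = j
  ring

theorem hasEuler_rightTerm (n : ℕ) (h4 : 1 + 4 * v ≠ 0) :
    HasEuler xWeight (rightTerm n) (logDer n v * rightTerm n v) v := by
  refine ((hasEuler_quad.mul ((hasEuler_inv_one_add_four_mul h4).pow 2)).mul
    ((hasEuler_tParam h4).pow_of_log n)).congr_val ?_
  simp only [logDer, logNum, rightTerm, xWeight]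
  generalize tParam v ^ n = T
  simp only [Nat.cast_ofNat, Nat.reduceSub, pow_one]
  field_simp
  ring

theorem hasEuler_rightTerm₁ (n : ℕ) (h4 : 1 + 4 * v ≠ 0) (h8 : 1 - 8 * v ^ 2 ≠ 0) :
    HasEuler xWeight (fun w => logDer n w * rightTerm n w)
      ((logDer₁ n v + logDer n v ^ 2) * rightTerm n v) v :=
  ((hasEuler_logDer n h4 h8).mul (hasEuler_rightTerm n h4)).congr_val (by ring)

theorem hasEuler_rightTerm₂ (n : ℕ) (h4 : 1 + 4 * v ≠ 0) (h8 : 1 - 8 * v ^ 2 ≠ 0) :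
    HasEuler xWeight (fun w => (logDer₁ n w + logDer n w ^ 2) * rightTerm n w)
      ((logDer₂ n v + 3 * logDer n v * logDer₁ n v + logDer n v ^ 3) * rightTerm n v) v :=
  (((hasEuler_logDer₁ n h4 h8).add ((hasEuler_logDer n h4 h8).pow 2)).mul
    (hasEuler_rightTerm n h4)).congr_val (by norm_num; ring)

/-- If `θR = λR`, then `θ²R` and `θ³R` are `R` times `λ₁ + λ²` and `λ₂ + 3λλ₁ + λ³`. The operator on
`rightTerm` thus reduces to a rational identity in `n` and `v`, and the factor in front does not
depend on `n`. -/
theorem odeForm_log (n : ℂ) (h4 : 1 + 4 * v ≠ 0) (h8 : 1 - 8 * v ^ 2 ≠ 0)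
    (h5 : 1 + 5 * v + 8 * v ^ 2 ≠ 0) :
    odeForm (xParam v) 1 (logDer n v) (logDer₁ n v + logDer n v ^ 2)
      (logDer₂ n v + 3 * logDer n v * logDer₁ n v + logDer n v ^ 3) =
    (1 - 8 * v) * (1 + 4 * v) ^ 3 / ((1 - 8 * v ^ 2) * (1 + 5 * v + 8 * v ^ 2)) *
      (n ^ 3 - tParam v * ((2 * n + 1) * (13 * n ^ 2 + 13 * n + 4)) -
        tParam v ^ 2 * (3 * (n + 1) * (3 * n + 2) * (3 * n + 4))) := by
  have e1 : logDer n v = logNum n v / ((1 + 4 * v) * (1 - 8 * v ^ 2)) := by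
    simp only [logDer]; field_simp
  have e2 : logDer₁ n v = logDerNum n v / ((1 + 4 * v) ^ 2 * (1 - 8 * v ^ 2) ^ 3) := by
    simp only [logDer₁]; field_simp
  have e3 : logDer₂ n v = v * (1 + 5 * v + 8 * v ^ 2) * (logDerNum' n v * (1 + 4 * v) *
      (1 - 8 * v ^ 2) + logDerNum n v * (48 * v * (1 + 4 * v) - 8 * (1 - 8 * v ^ 2))) /
      ((1 + 4 * v) ^ 3 * (1 - 8 * v ^ 2) ^ 5) := by
    simp only [logDer₂]
    generalize logDerNum n v = S
    generalize logDerNum' n v = S'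
    obtain ⟨a, ha⟩ : ∃ a, a = 1 + 4 * v := ⟨_, rfl⟩
    obtain ⟨b, hb⟩ : ∃ b, b = 1 - 8 * v ^ 2 := ⟨_, rfl⟩
    rw [← ha] at h4 ⊢
    rw [← hb] at h8 ⊢
    field_simp
  have e4 : tParam v = v / (1 + 4 * v) ^ 3 := by simp only [tParam]; field_simp
  rw [e1, e2, e3, e4, odeForm, xParam]
  -- Numerators and denominators become opaque letters while fractions are cleared, and are expanded
  -- only for the final polynomial check.
  obtain ⟨P, hP⟩ : ∃ P, P = logNum n v := ⟨_, rfl⟩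
  obtain ⟨S, hS⟩ : ∃ S, S = logDerNum n v := ⟨_, rfl⟩
  obtain ⟨S', hS'⟩ : ∃ S', S' = logDerNum' n v := ⟨_, rfl⟩
  obtain ⟨a, ha⟩ : ∃ a, a = 1 + 4 * v := ⟨_, rfl⟩
  obtain ⟨b, hb⟩ : ∃ b, b = 1 - 8 * v ^ 2 := ⟨_, rfl⟩
  obtain ⟨q, hq⟩ : ∃ q, q = 1 + 5 * v + 8 * v ^ 2 := ⟨_, rfl⟩
  rw [← hP, ← hS, ← hS', ← ha, ← hb, ← hq]
  rw [← ha] at h4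
  rw [← hb] at h8
  rw [← hq] at h5
  field_simp
  rw [hS, hS', hP]
  simp only [logDerNum, logDerNum', logNum, logNum']
  rw [ha, hb, hq]
  ring

end

/-! ### The differential operator applied to the terms of the left-hand side -/

theorem hasEuler_one_pow (k : ℕ) (x : ℂ) :
    HasEuler (fun _ => 1) (fun w => w ^ k) (k * x ^ k) x := by
  refine (HasEuler.id.pow k).congr_val ?_
  rcases k with _ | k
  · simp
  · rw [Nat.add_sub_cancel]; ring

theorem hasEuler_one_sum (a : ℕ → ℂ) (N : ℕ) (x : ℂ) :
    HasEuler (fun _ => 1) (fun w => ∑ k ∈ Finset.range N, a k * w ^ k)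
      (∑ k ∈ Finset.range N, k * a k * x ^ k) x := by
  refine (HasEuler.sum fun k _ => (hasEuler_one_pow k x).const_mul (a k)).congr_val ?_
  exact Finset.sum_congr rfl fun k _ => by ring

/-- Multiplying a coefficient by `k = n - (n - k)` gives `n` times the difference of the
coefficients of the square and of the mixed product. -/
theorem hasEuler_innerSum (n : ℕ) (x : ℂ) :
    HasEuler (fun _ => 1) (innerSum n) (n * (innerSum n x - mixedSum n x)) x := by
  refine (hasEuler_one_sum (sqCoeff n) (n + 1) x).congr_val ?_
  rw [innerSum_eq, mixedSum, ← Finset.sum_sub_distrib, Finset.mul_sum]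
  refine Finset.sum_congr rfl fun k _ => ?_
  linear_combination x ^ k * natCast_mul_mixedCoeff n k

theorem hasEuler_prevSum (n : ℕ) (x : ℂ) :
    HasEuler (fun _ => 1) (prevSum n) (n * (mixedSum n x - prevSum n x)) x := by
  refine (hasEuler_one_sum (prevCoeff n) (n + 1) x).congr_val ?_
  rw [prevSum, mixedSum, ← Finset.sum_sub_distrib, Finset.mul_sum]
  refine Finset.sum_congr rfl fun k _ => ?_
  linear_combination x ^ k * (add_mul_prevCoeff n k - natCast_mul_mixedCoeff n k)

/-- The denominator `1 + 4x = y²` is the only one introduced by `θ` on the rank-three module. -/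
theorem hasEuler_mixedSum (n : ℕ) {x : ℂ} (h : 1 + 4 * x ≠ 0) :
    HasEuler (fun _ => 1) (mixedSum n)
      ((n / 2 * (innerSum n x - prevSum n x) - 2 * x * mixedSum n x) * (1 + 4 * x)⁻¹) x := by
  refine (hasEuler_one_sum (mixedCoeff n) (n + 1) x).congr_val ?_
  rw [eq_mul_inv_iff_mul_eq₀ h]
  have split : (∑ k ∈ Finset.range (n + 1), (k : ℂ) * mixedCoeff n k * x ^ k) * (1 + 4 * x) +
      2 * x * mixedSum n x = ∑ k ∈ Finset.range (n + 1), (k : ℂ) * mixedCoeff n k * x ^ k +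
        ∑ k ∈ Finset.range n, (4 * k + 2) * mixedCoeff n k * x ^ (k + 1) := by
    -- The top mixed coefficient `k = n` is zero, so the shifted sum has no term of degree `n + 1`.
    have : ∑ k ∈ Finset.range n, (4 * (k : ℂ) + 2) * mixedCoeff n k * x ^ (k + 1) =
        ∑ k ∈ Finset.range (n + 1), (4 * (k : ℂ) + 2) * mixedCoeff n k * x ^ (k + 1) := by
      rw [Finset.sum_range_succ, mixedCoeff_eq_zero le_rfl]; ring
    rw [this, mixedSum, Finset.sum_mul, Finset.mul_sum, ← Finset.sum_add_distrib,
      ← Finset.sum_add_distrib]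
    exact Finset.sum_congr rfl fun k _ => by ring
  rw [eq_sub_iff_add_eq, split, innerSum_eq, prevSum, ← Finset.sum_sub_distrib, Finset.mul_sum,
    Finset.sum_range_succ', Finset.sum_range_succ' _ n, add_right_comm, ← Finset.sum_add_distrib]
  congr 1
  · refine Finset.sum_congr rfl fun k _ => ?_
    push_cast
    linear_combination x ^ (k + 1) * mixedCoeff_euler_succ n k
  · push_cast
    linear_combination -mixedCoeff_euler_zero n / 2

/-- `C(2n,n) xⁿ / (1 + x)^(2n+1)`. -/
noncomputable def leftWeight (n : ℕ) (x : ℂ) : ℂ :=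
  ((2 * n).choose n : ℂ) * (x ^ n * (1 + x)⁻¹ ^ (2 * n + 1))

/-- The logarithmic derivative of `leftWeight`. -/
noncomputable def leftLog (n x : ℂ) : ℂ := n - (2 * n + 1) * (x * (1 + x)⁻¹)

theorem hasEuler_inv_one_add {x : ℂ} (h : 1 + x ≠ 0) :
    HasEuler (fun _ => 1) (fun w => (1 + w)⁻¹) (-x * (1 + x)⁻¹ ^ 2) x :=
  (((HasEuler.const 1).add HasEuler.id).inv h).congr_val (by ring)

theorem hasEuler_inv_one_add_four {x : ℂ} (h : 1 + 4 * x ≠ 0) :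
    HasEuler (fun _ => 1) (fun w => (1 + 4 * w)⁻¹) (-(4 * x) * (1 + 4 * x)⁻¹ ^ 2) x :=
  (((HasEuler.const 1).add (HasEuler.id.const_mul 4)).inv h).congr_val (by ring)

theorem hasEuler_leftWeight (n : ℕ) {x : ℂ} (h : 1 + x ≠ 0) :
    HasEuler (fun _ => 1) (leftWeight n) (leftLog n x * leftWeight n x) x := by
  refine (((hasEuler_one_pow n x).mul ((hasEuler_inv_one_add h).pow (2 * n + 1))).const_mul
    ((2 * n).choose n : ℂ)).congr_val ?_
  simp only [leftWeight, leftLog]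
  rw [Nat.add_sub_cancel]
  push_cast
  ring

theorem hasEuler_leftLog (n : ℂ) {x : ℂ} (h : 1 + x ≠ 0) :
    HasEuler (fun _ => 1) (leftLog n) (-(2 * n + 1) * (x * (1 + x)⁻¹ ^ 2)) x := by
  refine ((HasEuler.const n).sub ((HasEuler.id.mul (hasEuler_inv_one_add h)).const_mul
    (2 * n + 1))).congr_val ?_
  field_simp
  ring

/-- `leftWeight` times a combination of the squares and products of Legendre polynomials. -/
noncomputable def leftComb (n : ℕ) (x a b d : ℂ) : ℂ :=
  leftWeight n x * (a * innerSum n x + b * mixedSum n x + d * prevSum n x)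

/-- Closure of the module under `θ`: differentiating acts on the coefficient triple `(a, b, d)` by a
first-order linear system, so iterating it gives the higher derivatives. -/
theorem hasEuler_leftComb (n : ℕ) {x a' b' d' : ℂ} {a b d : ℂ → ℂ} (h1 : 1 + x ≠ 0)
    (h4 : 1 + 4 * x ≠ 0) (ha : HasEuler (fun _ => 1) a a' x) (hb : HasEuler (fun _ => 1) b b' x)
    (hd : HasEuler (fun _ => 1) d d' x) :
    HasEuler (fun _ => 1) (fun w => leftComb n w (a w) (b w) (d w))
      (leftComb n x (a' + (leftLog n x + n) * a x + n / 2 * (1 + 4 * x)⁻¹ * b x)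
        (b' + leftLog n x * b x - n * a x - 2 * (x * (1 + 4 * x)⁻¹) * b x + n * d x)
        (d' + (leftLog n x - n) * d x - n / 2 * (1 + 4 * x)⁻¹ * b x)) x := by
  refine ((hasEuler_leftWeight n h1).mul (((ha.mul (hasEuler_innerSum n x)).add
    (hb.mul (hasEuler_mixedSum n h4))).add (hd.mul (hasEuler_prevSum n x)))).congr_val ?_
  simp only [leftComb]
  ring

/-- First coefficient of the second derivative of `leftTerm₀`. -/
noncomputable def combA₂ (n x : ℂ) : ℂ :=
  -(2 * n + 1) * (x * (1 + x)⁻¹ ^ 2) + (leftLog n x + n) ^ 2 - n ^ 2 / 2 * (1 + 4 * x)⁻¹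

/-- Second coefficient of the second derivative of `leftTerm₀`. -/
noncomputable def combB₂ (n x : ℂ) : ℂ :=
  -n * (2 * leftLog n x + n) + 2 * n * (x * (1 + 4 * x)⁻¹)

/-- Third coefficient of the second derivative of `leftTerm₀`. -/
noncomputable def combD₂ (n x : ℂ) : ℂ := n ^ 2 / 2 * (1 + 4 * x)⁻¹

/-- The derivative of `combA₂`. -/
noncomputable def combA₂' (n x : ℂ) : ℂ :=
  -(2 * n + 1) * (x * (1 + x)⁻¹ ^ 2 - 2 * (x ^ 2 * (1 + x)⁻¹ ^ 3)) +
    2 * (leftLog n x + n) * (-(2 * n + 1) * (x * (1 + x)⁻¹ ^ 2)) + 2 * n ^ 2 * (x * (1 + 4 * x)⁻¹ ^ 2)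

/-- The derivative of `combB₂`. -/
noncomputable def combB₂' (n x : ℂ) : ℂ :=
  2 * n * ((2 * n + 1) * (x * (1 + x)⁻¹ ^ 2)) +
    2 * n * (x * (1 + 4 * x)⁻¹ - 4 * (x ^ 2 * (1 + 4 * x)⁻¹ ^ 2))

/-- The derivative of `combD₂`. -/
noncomputable def combD₂' (n x : ℂ) : ℂ := -(2 * n ^ 2) * (x * (1 + 4 * x)⁻¹ ^ 2)

/-- The `n`-th term of the left-hand side, divided by `1 + x`. -/
noncomputable def leftTerm₀ (n : ℕ) (x : ℂ) : ℂ := leftComb n x 1 0 0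

/-- The derivative of `leftTerm₀`. -/
noncomputable def leftTerm₁ (n : ℕ) (x : ℂ) : ℂ := leftComb n x (leftLog n x + n) (-n) 0

/-- The second derivative of `leftTerm₀`. -/
noncomputable def leftTerm₂ (n : ℕ) (x : ℂ) : ℂ :=
  leftComb n x (combA₂ n x) (combB₂ n x) (combD₂ n x)

/-- The third derivative of `leftTerm₀`. -/
noncomputable def leftTerm₃ (n : ℕ) (x : ℂ) : ℂ :=
  leftComb n x
    (combA₂' n x + (leftLog n x + n) * combA₂ n x + n / 2 * (1 + 4 * x)⁻¹ * combB₂ n x)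
    (combB₂' n x + leftLog n x * combB₂ n x - n * combA₂ n x -
      2 * (x * (1 + 4 * x)⁻¹) * combB₂ n x + n * combD₂ n x)
    (combD₂' n x + (leftLog n x - n) * combD₂ n x - n / 2 * (1 + 4 * x)⁻¹ * combB₂ n x)

section

variable {x : ℂ} (n : ℕ)

theorem hasEuler_leftTerm₀ (h1 : 1 + x ≠ 0) (h4 : 1 + 4 * x ≠ 0) :
    HasEuler (fun _ => 1) (leftTerm₀ n) (leftTerm₁ n x) x := by
  refine (hasEuler_leftComb n h1 h4 (HasEuler.const 1) (HasEuler.const 0)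
    (HasEuler.const 0)).congr_val ?_
  simp only [leftTerm₁, leftComb]; ring

theorem hasEuler_leftTerm₁ (h1 : 1 + x ≠ 0) (h4 : 1 + 4 * x ≠ 0) :
    HasEuler (fun _ => 1) (leftTerm₁ n) (leftTerm₂ n x) x := by
  refine (hasEuler_leftComb n h1 h4 ((hasEuler_leftLog n h1).add (HasEuler.const (n : ℂ)))
    (HasEuler.const (-n : ℂ)) (HasEuler.const 0)).congr_val ?_
  simp only [leftTerm₂, leftComb, combA₂, combB₂, combD₂]; ring

theorem hasEuler_leftTerm₂ (h1 : 1 + x ≠ 0) (h4 : 1 + 4 * x ≠ 0) :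
    HasEuler (fun _ => 1) (leftTerm₂ n) (leftTerm₃ n x) x := by
  have hi := hasEuler_inv_one_add h1
  have hj := hasEuler_inv_one_add_four h4
  have hl := hasEuler_leftLog n h1
  have hA : HasEuler (fun _ => 1) (combA₂ n) (combA₂' n x) x := by
    refine ((((HasEuler.id.mul (hi.pow 2)).const_mul (-(2 * n + 1) : ℂ)).add
      ((hl.add (HasEuler.const (n : ℂ))).pow 2)).sub
      (hj.const_mul ((n : ℂ) ^ 2 / 2))).congr_val ?_
    simp only [combA₂', Nat.cast_ofNat, Nat.reduceSub, pow_one]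
    generalize (1 + x)⁻¹ = i
    generalize (1 + 4 * x)⁻¹ = j
    ring
  have hB : HasEuler (fun _ => 1) (combB₂ n) (combB₂' n x) x := by
    refine ((((hl.const_mul 2).add (HasEuler.const (n : ℂ))).const_mul (-n : ℂ)).add
      ((HasEuler.id.mul hj).const_mul (2 * n : ℂ))).congr_val ?_
    simp only [combB₂']; ring
  have hD : HasEuler (fun _ => 1) (combD₂ n) (combD₂' n x) x := by
    refine (hj.const_mul ((n : ℂ) ^ 2 / 2)).congr_val ?_
    simp only [combD₂']; ring
  exact hasEuler_leftComb n h1 h4 hA hB hD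

/-- The certificate whose difference in `n` is the image of `leftTerm₀`. -/
noncomputable def leftCert (n : ℕ) (x : ℂ) : ℂ :=
  leftComb n x (n ^ 3 * ((-11 - 15 * x + 3 * x ^ 2 + 7 * x ^ 3) / 2 * (1 + x)⁻¹))
    ((n ^ 2 * (2 * x + 18 * x ^ 2 + 30 * x ^ 3 + 14 * x ^ 4) +
      n ^ 3 * (6 + 20 * x + 30 * x ^ 2 - 12 * x ^ 3 - 28 * x ^ 4)) * (1 + x)⁻¹)
    ((n ^ 2 * (-2 * x + 10 * x ^ 2) + n ^ 3 * ((-3 - 11 * x + 19 * x ^ 2 - 21 * x ^ 3) / 2)) *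
      (1 + x)⁻¹)

theorem leftWeight_succ :
    leftWeight (n + 1) x =
      leftWeight n x * (2 * (2 * n + 1) / (n + 1) * (x * (1 + x)⁻¹ ^ 2)) := by
  have hn : (n : ℂ) + 1 ≠ 0 := by exact_mod_cast Nat.succ_ne_zero n
  have h2 : ((n : ℂ) + 1) * ((2 * (n + 1)).choose (n + 1) : ℂ) =
      2 * (2 * n + 1) * ((2 * n).choose n : ℂ) := by
    exact_mod_cast Nat.succ_mul_centralBinom_succ n
  have h3 : ((2 * (n + 1)).choose (n + 1) : ℂ) =
      2 * (2 * n + 1) / (n + 1) * ((2 * n).choose n : ℂ) := by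
    field_simp; linear_combination h2
  simp only [leftWeight]
  rw [h3, show 2 * (n + 1) + 1 = 2 * n + 1 + 2 by ring, pow_add, pow_succ]
  ring

/-- Creative telescoping in the rank-three module: once the index `n + 1` is rewritten in terms of
index `n`, both sides are linear in the three products, and the identity holds for arbitrary values
of them. -/
theorem odeForm_leftTerm (h1 : 1 + x ≠ 0) (h4 : 1 + 4 * x ≠ 0) :
    odeForm x (leftTerm₀ n x) (leftTerm₁ n x) (leftTerm₂ n x) (leftTerm₃ n x) =
      leftCert (n + 1) x - leftCert n x := by
  have hn : (n : ℂ) + 1 ≠ 0 := by exact_mod_cast Nat.succ_ne_zero n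
  have hA : innerSum (n + 1) x = ((2 * n + 1) ^ 2 * (1 + 4 * x) * innerSum n x -
        2 * n * (2 * n + 1) * (1 + 4 * x) * mixedSum n x + n ^ 2 * prevSum n x) / (n + 1) ^ 2 := by
    rw [eq_div_iff (pow_ne_zero 2 hn), mul_comm]; exact innerSum_succ n x
  have hB : mixedSum (n + 1) x = ((2 * n + 1) * innerSum n x - n * mixedSum n x) / (n + 1) := by
    rw [eq_div_iff hn, mul_comm]; exact mixedSum_succ n x
  simp only [leftCert, leftTerm₀, leftTerm₁, leftTerm₂, leftTerm₃, leftComb, leftWeight_succ, hA, hB,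
    prevSum_succ, odeForm, combA₂, combB₂, combD₂, combA₂', combB₂', combD₂', leftLog]
  push_cast
  generalize leftWeight n x = W
  generalize innerSum n x = A
  generalize mixedSum n x = B
  generalize prevSum n x = C
  generalize (n : ℂ) = m at *
  obtain ⟨a, ha⟩ : ∃ a, a = 1 + x := ⟨_, rfl⟩
  obtain ⟨b, hb⟩ : ∃ b, b = 1 + 4 * x := ⟨_, rfl⟩
  rw [← ha] at h1
  rw [← hb] at h4
  simp only [← ha, ← hb]
  obtain ⟨k, hk⟩ : ∃ k, k = m + 1 := ⟨_, rfl⟩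
  rw [← hk] at hn
  simp only [← hk]
  field_simp
  rw [hk, ha, hb]
  ring

end

/-! ### Growth bounds -/

theorem norm_sqCoeff_le (n k : ℕ) (hk : k ≤ n) : ‖sqCoeff n k‖ ≤ (n.choose k : ℝ) * 16 ^ n := by
  have h1 : ((n + k).choose n : ℝ) ≤ 4 ^ n := by
    have : (n + k).choose n ≤ 2 ^ (n + k) := Nat.choose_le_two_pow _ _
    calc ((n + k).choose n : ℝ) ≤ 2 ^ (n + k) := by exact_mod_cast this
      _ ≤ 2 ^ (2 * n) := pow_le_pow_right₀ (by norm_num) (by omega)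
      _ = 4 ^ n := by rw [pow_mul]; norm_num
  have h2 : ((2 * k).choose k : ℝ) ≤ 4 ^ n := by
    have : (2 * k).choose k ≤ 2 ^ (2 * k) := Nat.choose_le_two_pow _ _
    calc ((2 * k).choose k : ℝ) ≤ 2 ^ (2 * k) := by exact_mod_cast this
      _ ≤ 2 ^ (2 * n) := pow_le_pow_right₀ (by norm_num) (by omega)
      _ = 4 ^ n := by rw [pow_mul]; norm_num
  rw [sqCoeff, legendreCoeff, norm_mul, norm_mul, Complex.norm_natCast, Complex.norm_natCast,
    Complex.norm_natCast]
  calc (n.choose k : ℝ) * ((n + k).choose n : ℝ) * ((2 * k).choose k : ℝ)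
      ≤ (n.choose k : ℝ) * 4 ^ n * 4 ^ n := by gcongr
    _ = (n.choose k : ℝ) * 16 ^ n := by rw [mul_assoc, ← mul_pow]; norm_num

/-- One bound for all three products, since the mixed and previous coefficients are at most those of
the square in norm; `32 = 2 · 16`, with `2 ^ n` from summing `C(n, k)`. -/
theorem norm_sum_le_of_coeff_le {n : ℕ} {a : ℕ → ℂ} (h : ∀ k ≤ n, ‖a k‖ ≤ ‖sqCoeff n k‖) {x : ℂ}
    (hx : ‖x‖ ≤ 1) : ‖∑ k ∈ Finset.range (n + 1), a k * x ^ k‖ ≤ 32 ^ n := by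
  have hsum : ∑ k ∈ Finset.range (n + 1), (n.choose k : ℝ) = 2 ^ n := by
    exact_mod_cast Nat.sum_range_choose n
  calc ‖∑ k ∈ Finset.range (n + 1), a k * x ^ k‖
      ≤ ∑ k ∈ Finset.range (n + 1), (n.choose k : ℝ) * 16 ^ n := by
        refine norm_sum_le_of_le _ fun k hk => ?_
        have hk' : k ≤ n := by simp only [Finset.mem_range] at hk; omega
        rw [norm_mul, norm_pow]
        calc ‖a k‖ * ‖x‖ ^ k ≤ ‖a k‖ * 1 := by
              gcongr; exact pow_le_one₀ (norm_nonneg x) hx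
          _ ≤ _ := by rw [mul_one]; exact (h k hk').trans (norm_sqCoeff_le n k hk')
    _ = 32 ^ n := by rw [← Finset.sum_mul, hsum, ← mul_pow]; norm_num

theorem norm_natCast_sub_div_le {n k : ℕ} (hk : k ≤ n) {d : ℕ} (hd : n ≤ d) :
    ‖((n : ℂ) - k) / (d : ℂ)‖ ≤ 1 := by
  rw [← Nat.cast_sub hk, norm_div, Complex.norm_natCast, Complex.norm_natCast]
  refine div_le_one_of_le₀ ?_ (Nat.cast_nonneg d)
  exact_mod_cast (Nat.sub_le n k).trans hd

theorem norm_innerSum_le (n : ℕ) {x : ℂ} (hx : ‖x‖ ≤ 1) : ‖innerSum n x‖ ≤ 32 ^ n :=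
  norm_sum_le_of_coeff_le (a := sqCoeff n) (fun _ _ => le_rfl) hx

theorem norm_mixedSum_le (n : ℕ) {x : ℂ} (hx : ‖x‖ ≤ 1) : ‖mixedSum n x‖ ≤ 32 ^ n := by
  refine norm_sum_le_of_coeff_le (fun k hk => ?_) hx
  rw [mixedCoeff, norm_mul]
  exact mul_le_of_le_one_left (norm_nonneg _) (norm_natCast_sub_div_le hk le_rfl)

theorem norm_prevSum_le (n : ℕ) {x : ℂ} (hx : ‖x‖ ≤ 1) : ‖prevSum n x‖ ≤ 32 ^ n := by
  refine norm_sum_le_of_coeff_le (fun k hk => ?_) hx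
  rw [prevCoeff, norm_mul, ← Nat.cast_add]
  exact mul_le_of_le_one_left (norm_nonneg _) (norm_natCast_sub_div_le hk (Nat.le_add_right n k))

/-- The threshold `1 / 1024` is chosen so that `4 · 32 / 1024 = 1 / 8`. -/
theorem norm_leftWeight_mul_le (n : ℕ) {x s : ℂ} (hi : ‖(1 + x)⁻¹‖ ≤ 2)
    (hz : ‖x * (1 + x)⁻¹ ^ 2‖ ≤ 1 / 1024) (hs : ‖s‖ ≤ 32 ^ n) :
    ‖leftWeight n x * s‖ ≤ 2 * (1 / 8) ^ n := by
  have h1 : ((2 * n).choose n : ℝ) ≤ 4 ^ n := by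
    have : (2 * n).choose n ≤ 2 ^ (2 * n) := Nat.choose_le_two_pow _ _
    calc ((2 * n).choose n : ℝ) ≤ 2 ^ (2 * n) := by exact_mod_cast this
      _ = 4 ^ n := by rw [pow_mul]; norm_num
  have e : leftWeight n x * s =
      ((2 * n).choose n : ℂ) * (x * (1 + x)⁻¹ ^ 2) ^ n * (1 + x)⁻¹ * s := by
    rw [leftWeight, pow_succ, mul_pow, ← pow_mul]; ring
  rw [e, norm_mul, norm_mul, norm_mul, norm_pow, Complex.norm_natCast]
  calc ((2 * n).choose n : ℝ) * ‖x * (1 + x)⁻¹ ^ 2‖ ^ n * ‖(1 + x)⁻¹‖ * ‖s‖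
      ≤ 4 ^ n * (1 / 1024) ^ n * 2 * 32 ^ n := by gcongr
    _ = 2 * (4 * (1 / 1024) * 32) ^ n := by rw [mul_pow, mul_pow]; ring
    _ = 2 * (1 / 8) ^ n := by norm_num

theorem norm_aperyNat_le (n : ℕ) : ‖(aperyNat n : ℂ)‖ ≤ 64 ^ n := by
  have h (k : ℕ) (hk : k ∈ Finset.range (n + 1)) :
      n.choose k ^ 2 * (n + k).choose n * (2 * k).choose n ≤ n.choose k * 32 ^ n := by
    have hk' : k ≤ n := by simp only [Finset.mem_range] at hk; omega
    have h0 : n.choose k ≤ 2 ^ n := Nat.choose_le_two_pow _ _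
    have h1 : (n + k).choose n ≤ 4 ^ n :=
      calc (n + k).choose n ≤ 2 ^ (n + k) := Nat.choose_le_two_pow _ _
        _ ≤ 2 ^ (2 * n) := Nat.pow_le_pow_right (by norm_num) (by omega)
        _ = 4 ^ n := by rw [pow_mul]; norm_num
    have h2 : (2 * k).choose n ≤ 4 ^ n :=
      calc (2 * k).choose n ≤ 2 ^ (2 * k) := Nat.choose_le_two_pow _ _
        _ ≤ 2 ^ (2 * n) := Nat.pow_le_pow_right (by norm_num) (by omega)
        _ = 4 ^ n := by rw [pow_mul]; norm_num
    calc n.choose k ^ 2 * (n + k).choose n * (2 * k).choose n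
        = n.choose k * (n.choose k * (n + k).choose n * (2 * k).choose n) := by ring
      _ ≤ n.choose k * (2 ^ n * 4 ^ n * 4 ^ n) := by gcongr
      _ = n.choose k * 32 ^ n := by rw [← mul_pow, ← mul_pow]; norm_num
  have hN : ∑ k ∈ Finset.range (n + 1), n.choose k ^ 2 * (n + k).choose n * (2 * k).choose n ≤
      64 ^ n := by
    refine (Finset.sum_le_sum h).trans (le_of_eq ?_)
    rw [← Finset.sum_mul, Nat.sum_range_choose, ← mul_pow]; norm_num
  have e : (aperyNat n : ℂ) = ((∑ k ∈ Finset.range (n + 1),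
      n.choose k ^ 2 * (n + k).choose n * (2 * k).choose n : ℕ) : ℂ) := by
    simp [aperyNat]
  rw [e, Complex.norm_natCast]
  exact_mod_cast hN

theorem norm_aperyNat_mul_pow_le (n : ℕ) {t : ℂ} (ht : ‖t‖ ≤ 1 / 512) :
    ‖(aperyNat n : ℂ) * t ^ n‖ ≤ (1 / 8) ^ n := by
  rw [norm_mul, norm_pow]
  calc ‖(aperyNat n : ℂ)‖ * ‖t‖ ^ n ≤ 64 ^ n * (1 / 512) ^ n := by
        gcongr; exact norm_aperyNat_le n
    _ = (1 / 8) ^ n := by rw [← mul_pow]; norm_num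

theorem tendsto_pow_mul_of_norm_le {s : ℕ → ℂ} {K : ℝ} (hs : ∀ n, ‖s n‖ ≤ K * (1 / 8) ^ n) (j : ℕ) :
    Tendsto (fun n : ℕ => (n : ℂ) ^ j * s n) atTop (𝓝 0) := by
  have h := (tendsto_pow_const_mul_const_pow_of_abs_lt_one j
    (show |(1 / 8 : ℝ)| < 1 by rw [abs_of_pos] <;> norm_num)).const_mul K
  rw [mul_zero] at h
  refine squeeze_zero_norm (fun n => ?_) h
  rw [norm_mul, norm_pow, Complex.norm_natCast]
  calc (n : ℝ) ^ j * ‖s n‖ ≤ (n : ℝ) ^ j * (K * (1 / 8) ^ n) := by gcongr; exact hs n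
    _ = K * ((n : ℝ) ^ j * (1 / 8) ^ n) := by ring

theorem tendsto_leftCert {x : ℂ} (hx : ‖x‖ ≤ 1) (hi : ‖(1 + x)⁻¹‖ ≤ 2)
    (hz : ‖x * (1 + x)⁻¹ ^ 2‖ ≤ 1 / 1024) :
    Tendsto (fun n => leftCert n x) atTop (𝓝 0) := by
  have hA := tendsto_pow_mul_of_norm_le
    (fun n => norm_leftWeight_mul_le n hi hz (norm_innerSum_le n hx))
  have hB := tendsto_pow_mul_of_norm_le
    (fun n => norm_leftWeight_mul_le n hi hz (norm_mixedSum_le n hx))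
  have hC := tendsto_pow_mul_of_norm_le
    (fun n => norm_leftWeight_mul_le n hi hz (norm_prevSum_le n hx))
  have h := (((((hA 3).const_mul ((-11 - 15 * x + 3 * x ^ 2 + 7 * x ^ 3) / 2 * (1 + x)⁻¹)).add
    ((hB 2).const_mul ((2 * x + 18 * x ^ 2 + 30 * x ^ 3 + 14 * x ^ 4) * (1 + x)⁻¹))).add
    ((hB 3).const_mul ((6 + 20 * x + 30 * x ^ 2 - 12 * x ^ 3 - 28 * x ^ 4) * (1 + x)⁻¹))).add
    ((hC 2).const_mul ((-2 * x + 10 * x ^ 2) * (1 + x)⁻¹))).add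
    ((hC 3).const_mul ((-3 - 11 * x + 19 * x ^ 2 - 21 * x ^ 3) / 2 * (1 + x)⁻¹))
  simp only [mul_zero, add_zero] at h
  refine h.congr fun n => ?_
  simp only [leftCert, leftComb]
  ring

/-- The image of `tⁿ` under the operator annihilating `∑ u_n tⁿ`. -/
def aperyForm (n : ℕ) (t : ℂ) : ℂ :=
  (n : ℂ) ^ 3 - t * ((2 * n + 1) * (13 * n ^ 2 + 13 * n + 4)) -
    t ^ 2 * (3 * (n + 1) * (3 * n + 2) * (3 * n + 4))

/-- The recurrence cancels every interior power of `t`, leaving only the boundary terms in `t ^ (N +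
1)` and `t ^ (N + 2)`. -/
theorem sum_aperyForm (N : ℕ) (t : ℂ) :
    ∑ n ∈ Finset.range (N + 1), aperyForm n t * (aperyNat n * t ^ n) =
      -(((N : ℂ) + 1) ^ 3 * aperyNat (N + 1) * t ^ (N + 1)) -
        3 * (N + 1) * (3 * N + 2) * (3 * N + 4) * aperyNat N * t ^ (N + 2) := by
  induction N with
  | zero => simp [aperyForm, aperyNat_zero, aperyNat_one]; ring
  | succ N ih =>
    have h : ((N : ℂ) + 2) ^ 3 * aperyNat (N + 2) =
      (2 * N + 3) * (13 * (N + 1) ^ 2 + 13 * (N + 1) + 4) * aperyNat (N + 1) +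
      3 * (N + 1) * (3 * N + 2) * (3 * N + 4) * aperyNat N := by
      exact_mod_cast congrArg (Int.cast : ℤ → ℂ) (aperyNat_recurrence N)
    rw [Finset.sum_range_succ, ih]
    simp only [aperyForm]
    push_cast
    linear_combination t ^ (N + 2) * h

theorem tendsto_sum_aperyForm {t : ℂ} (ht : ‖t‖ ≤ 1 / 512) :
    Tendsto (fun N => ∑ n ∈ Finset.range N, aperyForm n t * (aperyNat n * t ^ n)) atTop (𝓝 0) := by
  have hu := tendsto_pow_mul_of_norm_le (K := 1)
    (fun n => (norm_aperyNat_mul_pow_le n ht).trans_eq (one_mul _).symm)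
  rw [← tendsto_add_atTop_iff_nat 1]
  have h3 := (tendsto_add_atTop_iff_nat 1).mpr (hu 3)
  -- The constants expand `3(N + 1)(3N + 2)(3N + 4) = 27N³ + 81N² + 78N + 24`.
  have h := (h3.neg.sub (((hu 0).const_mul (24 * t ^ 2)).add (((hu 1).const_mul (78 * t ^ 2)).add
    (((hu 2).const_mul (81 * t ^ 2)).add ((hu 3).const_mul (27 * t ^ 2))))))
  simp only [mul_zero, add_zero, neg_zero, sub_zero] at h
  refine h.congr fun N => ?_
  rw [sum_aperyForm]
  push_cast
  ring

/-! ### Comparison of the two sides -/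

/-- A neighbourhood of the origin on which all series converge geometrically. -/
structure Admissible (v : ℂ) : Prop where
  four : 1 + 4 * v ≠ 0
  two : 1 + 2 * v ≠ 0
  eight : 1 - 8 * v ^ 2 ≠ 0
  quad : 1 + 5 * v + 8 * v ^ 2 ≠ 0
  one_add : 1 + xParam v ≠ 0
  one_add_four : 1 + 4 * xParam v ≠ 0
  norm_x : ‖xParam v‖ < 1
  norm_inv : ‖(1 + xParam v)⁻¹‖ < 2
  norm_z : ‖xParam v * (1 + xParam v)⁻¹ ^ 2‖ < 1 / 1024
  norm_t : ‖tParam v‖ < 1 / 512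
  norm_m : ‖(1 + 5 * v + 8 * v ^ 2) * (1 + 4 * v)⁻¹ ^ 2‖ < 2

theorem xParam_zero : xParam 0 = 0 := by simp [xParam]

theorem continuousAt_xParam : ContinuousAt xParam 0 := by
  refine ContinuousAt.div (by fun_prop) (by fun_prop) (by norm_num)

theorem eventually_admissible : ∀ᶠ v : ℂ in 𝓝 0, Admissible v := by
  have hx := continuousAt_xParam
  have hx1 : ContinuousAt (fun v => (1 + xParam v)⁻¹) 0 :=
    (continuousAt_const.add hx).inv₀ (by simp [xParam_zero])
  have h4 : ContinuousAt (fun v : ℂ => (1 + 4 * v)⁻¹) 0 :=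
    ContinuousAt.inv₀ (by fun_prop) (by norm_num)
  have c1 : ContinuousAt (fun v : ℂ => 1 + 4 * v) 0 := by fun_prop
  have c2 : ContinuousAt (fun v : ℂ => 1 + 2 * v) 0 := by fun_prop
  have c3 : ContinuousAt (fun v : ℂ => 1 - 8 * v ^ 2) 0 := by fun_prop
  have c4 : ContinuousAt (fun v : ℂ => 1 + 5 * v + 8 * v ^ 2) 0 := by fun_prop
  have c5 : ContinuousAt (fun v : ℂ => 1 + xParam v) 0 := continuousAt_const.add hx
  have c6 : ContinuousAt (fun v : ℂ => 1 + 4 * xParam v) 0 :=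
    continuousAt_const.add (continuousAt_const.mul hx)
  have c7 : ContinuousAt (fun v : ℂ => ‖xParam v * (1 + xParam v)⁻¹ ^ 2‖) 0 :=
    (hx.mul (hx1.pow 2)).norm
  have c8 : ContinuousAt (fun v : ℂ => ‖tParam v‖) 0 := (continuousAt_id.mul (h4.pow 3)).norm
  have c9 : ContinuousAt (fun v : ℂ => ‖(1 + 5 * v + 8 * v ^ 2) * (1 + 4 * v)⁻¹ ^ 2‖) 0 :=
    (c4.mul (h4.pow 2)).norm
  filter_upwards [c1.eventually_ne (y := (0 : ℂ)) (by norm_num), c2.eventually_ne (y := (0 : ℂ)) (by norm_num),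
    c3.eventually_ne (y := (0 : ℂ)) (by norm_num), c4.eventually_ne (y := (0 : ℂ)) (by norm_num),
    c5.eventually_ne (y := (0 : ℂ)) (by simp [xParam_zero]),
    c6.eventually_ne (y := (0 : ℂ)) (by simp [xParam_zero]),
    hx.norm.eventually_lt_const (u := 1) (by simp [xParam_zero]),
    hx1.norm.eventually_lt_const (u := 2) (by norm_num [xParam_zero]),
    c7.eventually_lt_const (u := 1 / 1024) (by norm_num [xParam_zero]),
    c8.eventually_lt_const (u := 1 / 512) (by norm_num [tParam]),
    c9.eventually_lt_const (u := 2) (by norm_num)] with v a1 a2 a3 a4 a5 a6 a7 a8 a9 a10 a11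
  exact ⟨a1, a2, a3, a4, a5, a6, a7, a8, a9, a10, a11⟩

theorem Admissible.xParam_mul {v : ℂ} (hv : Admissible v) :
    xParam v * (1 + 5 * v + 8 * v ^ 2) = v :=
  div_mul_cancel₀ v hv.quad

/-- Shows that `xWeight` is the right weight: the derivation in `v` sends `x` to itself, as `x d/dx`
does. -/
theorem hasEuler_xParam {v : ℂ} (hv : Admissible v) :
    HasEuler xWeight xParam (xParam v * 1) v := by
  have h5 := hv.quad
  have h8 := hv.eight
  have h : HasEuler xWeight (fun w => w * (1 + 5 * w + 8 * w ^ 2)⁻¹) (xParam v * 1) v := by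
    refine (HasEuler.id.mul (hasEuler_quad.inv h5)).congr_val ?_
    simp only [xParam, xWeight]
    obtain ⟨q, hq⟩ : ∃ q, q = 1 + 5 * v + 8 * v ^ 2 := ⟨_, rfl⟩
    obtain ⟨b, hb⟩ : ∃ b, b = 1 - 8 * v ^ 2 := ⟨_, rfl⟩
    rw [← hq] at h5
    rw [← hb] at h8
    rw [← hq, ← hb]
    field_simp
    rw [hq, hb]
    ring
  exact h.congr_fun fun w => by rw [xParam, div_eq_mul_inv]

theorem norm_leftTerm₀_le {v : ℂ} (hv : Admissible v) (n : ℕ) :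
    ‖leftTerm₀ n (xParam v)‖ ≤ 2 * (1 / 8) ^ n := by
  have h := norm_leftWeight_mul_le n hv.norm_inv.le hv.norm_z.le
    (norm_innerSum_le n hv.norm_x.le)
  rw [leftTerm₀, leftComb]
  simpa using h

theorem norm_rightTerm_le {v : ℂ} (hv : Admissible v) (n : ℕ) :
    ‖(aperyNat n : ℂ) * rightTerm n v‖ ≤ 2 * (1 / 8) ^ n := by
  have h := norm_aperyNat_mul_pow_le n hv.norm_t.le
  have e : (aperyNat n : ℂ) * rightTerm n v =
      (1 + 5 * v + 8 * v ^ 2) * (1 + 4 * v)⁻¹ ^ 2 * ((aperyNat n : ℂ) * tParam v ^ n) := by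
    rw [rightTerm]; ring
  rw [e, norm_mul]
  exact mul_le_mul hv.norm_m.le h (norm_nonneg _) (by norm_num)

theorem summable_geometric_eighth (K : ℝ) : Summable fun n : ℕ => K * (1 / 8 : ℝ) ^ n :=
  (summable_geometric_of_lt_one (by norm_num) (by norm_num)).mul_left K

/-- The `n`-th term of the difference of the two sides, divided by `1 + x`. -/
noncomputable def diffTerm (n : ℕ) (v : ℂ) : ℂ :=
  leftTerm₀ n (xParam v) - aperyNat n * rightTerm n v

/-- The derivative of `diffTerm`. -/
noncomputable def diffTerm₁ (n : ℕ) (v : ℂ) : ℂ :=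
  leftTerm₁ n (xParam v) - aperyNat n * (logDer n v * rightTerm n v)

/-- The second derivative of `diffTerm`. -/
noncomputable def diffTerm₂ (n : ℕ) (v : ℂ) : ℂ :=
  leftTerm₂ n (xParam v) - aperyNat n * ((logDer₁ n v + logDer n v ^ 2) * rightTerm n v)

/-- The third derivative of `diffTerm`. -/
noncomputable def diffTerm₃ (n : ℕ) (v : ℂ) : ℂ :=
  leftTerm₃ n (xParam v) - aperyNat n *
    ((logDer₂ n v + 3 * logDer n v * logDer₁ n v + logDer n v ^ 3) * rightTerm n v)

theorem hasEuler_diffTerm {v : ℂ} (hv : Admissible v) (n : ℕ) :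
    HasEuler xWeight (diffTerm n) (diffTerm₁ n v) v :=
  ((hasEuler_leftTerm₀ n hv.one_add hv.one_add_four).comp (hasEuler_xParam hv)).sub
    ((hasEuler_rightTerm n hv.four).const_mul (aperyNat n : ℂ))

theorem hasEuler_diffTerm₁ {v : ℂ} (hv : Admissible v) (n : ℕ) :
    HasEuler xWeight (diffTerm₁ n) (diffTerm₂ n v) v :=
  ((hasEuler_leftTerm₁ n hv.one_add hv.one_add_four).comp (hasEuler_xParam hv)).sub
    ((hasEuler_rightTerm₁ n hv.four hv.eight).const_mul (aperyNat n : ℂ))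

theorem hasEuler_diffTerm₂ {v : ℂ} (hv : Admissible v) (n : ℕ) :
    HasEuler xWeight (diffTerm₂ n) (diffTerm₃ n v) v :=
  ((hasEuler_leftTerm₂ n hv.one_add hv.one_add_four).comp (hasEuler_xParam hv)).sub
    ((hasEuler_rightTerm₂ n hv.four hv.eight).const_mul (aperyNat n : ℂ))

theorem odeForm_sum (x : ℂ) (f₀ f₁ f₂ f₃ : ℕ → ℂ) (N : ℕ) :
    odeForm x (∑ n ∈ Finset.range N, f₀ n) (∑ n ∈ Finset.range N, f₁ n)
      (∑ n ∈ Finset.range N, f₂ n) (∑ n ∈ Finset.range N, f₃ n) =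
    ∑ n ∈ Finset.range N, odeForm x (f₀ n) (f₁ n) (f₂ n) (f₃ n) := by
  simp only [odeForm, Finset.mul_sum, Finset.sum_add_distrib]

theorem odeForm_diffTerm {v : ℂ} (hv : Admissible v) (n : ℕ) :
    odeForm (xParam v) (diffTerm n v) (diffTerm₁ n v) (diffTerm₂ n v) (diffTerm₃ n v) =
      (leftCert (n + 1) (xParam v) - leftCert n (xParam v)) -
      (1 - 8 * v) * (1 + 4 * v) ^ 3 / ((1 - 8 * v ^ 2) * (1 + 5 * v + 8 * v ^ 2)) *
        ((1 + 5 * v + 8 * v ^ 2) * (1 + 4 * v)⁻¹ ^ 2) *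
        (aperyForm n (tParam v) * (aperyNat n * tParam v ^ n)) := by
  have h1 := odeForm_leftTerm n hv.one_add hv.one_add_four
  have h2 := odeForm_log (n : ℂ) hv.four hv.eight hv.quad
  rw [← h1]
  have h3 : (1 - 8 * v) * (1 + 4 * v) ^ 3 / ((1 - 8 * v ^ 2) * (1 + 5 * v + 8 * v ^ 2)) *
      ((1 + 5 * v + 8 * v ^ 2) * (1 + 4 * v)⁻¹ ^ 2) *
      (aperyForm n (tParam v) * (aperyNat n * tParam v ^ n)) =
      aperyNat n * rightTerm n v *
      ((1 - 8 * v) * (1 + 4 * v) ^ 3 / ((1 - 8 * v ^ 2) * (1 + 5 * v + 8 * v ^ 2)) *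
        aperyForm n (tParam v)) := by
    rw [rightTerm]; ring
  rw [h3, aperyForm, ← h2]
  simp only [odeForm, diffTerm, diffTerm₁, diffTerm₂, diffTerm₃]
  ring

theorem tendsto_odeForm_diffTerm {v : ℂ} (hv : Admissible v) :
    Tendsto (fun N => odeForm (xParam v) (∑ n ∈ Finset.range N, diffTerm n v)
      (∑ n ∈ Finset.range N, diffTerm₁ n v) (∑ n ∈ Finset.range N, diffTerm₂ n v)
      (∑ n ∈ Finset.range N, diffTerm₃ n v)) atTop (𝓝 0) := by
  have h1 := tendsto_leftCert hv.norm_x.le hv.norm_inv.le hv.norm_z.le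
  have h2 := (tendsto_sum_aperyForm hv.norm_t.le).const_mul
    ((1 - 8 * v) * (1 + 4 * v) ^ 3 / ((1 - 8 * v ^ 2) * (1 + 5 * v + 8 * v ^ 2)) *
        ((1 + 5 * v + 8 * v ^ 2) * (1 + 4 * v)⁻¹ ^ 2))
  have h := h1.sub h2
  rw [mul_zero, sub_zero] at h
  refine h.congr fun N => ?_
  rw [odeForm_sum]
  simp only [odeForm_diffTerm hv]
  rw [Finset.sum_sub_distrib, Finset.sum_range_sub (fun n => leftCert n (xParam v)),
    ← Finset.mul_sum]
  have h0 : leftCert 0 (xParam v) = 0 := by simp [leftCert, leftComb]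
  rw [h0, sub_zero]

theorem diffTerm_zero (n : ℕ) : diffTerm n 0 = 0 := by
  rcases n with _ | n
  · simp [diffTerm, leftTerm₀, leftComb, leftWeight, rightTerm, xParam_zero, innerSum_zero,
      aperyNat_zero]
  · simp [diffTerm, leftTerm₀, leftComb, leftWeight, rightTerm, xParam_zero, tParam]

/-- Uniform geometric bounds allow three termwise differentiations, so the sum is an analytic
solution to which the uniqueness result at the origin applies. -/
theorem eventually_tsum_diffTerm_eq_zero : ∀ᶠ v : ℂ in 𝓝 0, ∑' n, diffTerm n v = 0 := by
  obtain ⟨U, hU, hUo, h0⟩ := eventually_nhds_iff.mp eventually_admissible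
  set E : ℂ → ℂ := fun v => ∑' n, diffTerm n v with hE
  have hbound (n : ℕ) (v : ℂ) (hv : v ∈ U) : ‖diffTerm n v‖ ≤ 4 * (1 / 8) ^ n := by
    have h1 := norm_leftTerm₀_le (hU v hv) n
    have h2 := norm_rightTerm_le (hU v hv) n
    refine (norm_sub_le _ _).trans ?_
    linarith
  have hc : ContinuousOn xWeight U := by
    refine ContinuousOn.mul (by fun_prop) (ContinuousOn.inv₀ (by fun_prop) fun v hv => ?_)
    exact (hU v hv).eight
  have t0 : TendstoLocallyUniformlyOn (fun N v => ∑ n ∈ Finset.range N, diffTerm n v) E atTop U :=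
    (tendstoUniformlyOn_tsum_nat (summable_geometric_eighth 4) hbound).tendstoLocallyUniformlyOn
  have t1 := tendstoLocallyUniformlyOn_eulerD hUo hc
    (fun N v hv => HasEuler.sum fun n _ => hasEuler_diffTerm (hU v hv) n) t0
  have t2 := tendstoLocallyUniformlyOn_eulerD hUo hc
    (fun N v hv => HasEuler.sum fun n _ => hasEuler_diffTerm₁ (hU v hv) n) t1
  have t3 := tendstoLocallyUniformlyOn_eulerD hUo hc
    (fun N v hv => HasEuler.sum fun n _ => hasEuler_diffTerm₂ (hU v hv) n) t2
  have hEan : AnalyticAt ℂ E 0 := by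
    refine DifferentiableOn.analyticAt (t0.differentiableOn (Eventually.of_forall fun N v hv => ?_)
      hUo) (hUo.mem_nhds h0)
    exact (HasEuler.sum fun n _ =>
      hasEuler_diffTerm (hU v hv) n).differentiableAt.differentiableWithinAt
  have hE0 : E 0 = 0 := by simp [hE, diffTerm_zero]
  have hcan : AnalyticAt ℂ xWeight 0 := by
    refine AnalyticAt.mul (by fun_prop) (AnalyticAt.inv (by fun_prop) (by norm_num))
  have hx := continuousAt_xParam
  refine eventually_eq_zero_of_euler_ode hcan (by simp [xWeight]) hEan hE0
    (q₀ := fun v => -xParam v - 51 * xParam v ^ 2 - 84 * xParam v ^ 3)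
    (q₁ := fun v => -5 * xParam v - 145 * xParam v ^ 2 - 182 * xParam v ^ 3)
    (q₂ := fun v => -9 * xParam v - 141 * xParam v ^ 2 - 126 * xParam v ^ 3)
    (q₃ := fun v => 1 - 6 * xParam v - 47 * xParam v ^ 2 - 28 * xParam v ^ 3)
    (by fun_prop) (by fun_prop) (by fun_prop) (by fun_prop)
    (by simp [xParam_zero]) (by simp [xParam_zero]) (by simp [xParam_zero])
    (by simp [xParam_zero]) ?_
  filter_upwards [hUo.mem_nhds h0] with v hv
  -- The operator applied to the partial sums converges both to its value on the full sum and, by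
  -- telescoping, to `0`.
  refine tendsto_nhds_unique ?_ (tendsto_odeForm_diffTerm (hU v hv))
  exact ((((t3.tendsto_at hv).const_mul _).add ((t2.tendsto_at hv).const_mul _)).add
    ((t1.tendsto_at hv).const_mul _)).add ((t0.tendsto_at hv).const_mul _)

/-! ### Return from the normalised series to the stated identities. -/

theorem zParam_eq {v : ℂ} (hv : Admissible v) :
    zParam v = v * (1 + 5 * v + 8 * v ^ 2) / ((1 + 2 * v) ^ 2 * (1 + 4 * v) ^ 2) := by
  have h5 := hv.quad
  have h2 := hv.two
  have h4 := hv.four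
  have e : 1 + xParam v = (1 + 2 * v) * (1 + 4 * v) / (1 + 5 * v + 8 * v ^ 2) := by
    rw [eq_div_iff h5]; linear_combination hv.xParam_mul
  rw [zParam, e, xParam]
  field_simp

theorem sqrt_sq (a : ℂ) : Complex.sqrt a ^ 2 = a := by
  rw [Complex.sqrt]
  exact Complex.cpow_ofNat_inv_pow a 2

theorem yParam_sq {v : ℂ} (hv : Admissible v) : yParam v ^ 2 = 1 + 4 * xParam v := by
  have h5 := hv.quad
  rw [yParam, div_pow, sqrt_sq, sqrt_sq, div_eq_iff h5]
  linear_combination -4 * hv.xParam_mul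

theorem left_term_eq {v : ℂ} (hv : Admissible v) (n : ℕ) :
    ((2 * n).choose n : ℂ) * zParam v ^ n * innerSum n (xParam v) =
      (1 + xParam v) * leftTerm₀ n (xParam v) := by
  have h1 := hv.one_add
  rw [leftTerm₀, leftComb, leftWeight, zParam, div_eq_mul_inv, mul_pow, ← inv_pow, ← pow_mul,
    pow_succ]
  field_simp
  ring

theorem tParam_eq (v : ℂ) : tParam v = v / (1 + 4 * v) ^ 3 := by
  rw [tParam, div_eq_mul_inv, inv_pow]

theorem summable_apery {v : ℂ} (hv : Admissible v) :
    Summable (fun n : ℕ => (apery n : ℂ) * (v / (1 + 4 * v) ^ 3) ^ n) := by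
  refine Summable.of_norm_bounded (summable_geometric_eighth 1) fun n => ?_
  rw [← tParam_eq, one_mul]
  exact norm_aperyNat_mul_pow_le n hv.norm_t.le

theorem hasSum_left {v : ℂ} (hv : Admissible v) (h : ∑' n, diffTerm n v = 0) :
    HasSum (fun n : ℕ => ((2 * n).choose n : ℂ) * zParam v ^ n * innerSum n (xParam v))
      ((1 + 2 * v) / (1 + 4 * v) * ∑' n : ℕ, (apery n : ℂ) * (v / (1 + 4 * v) ^ 3) ^ n) := by
  have s1 : Summable fun n => leftTerm₀ n (xParam v) :=
    Summable.of_norm_bounded (summable_geometric_eighth 2) (norm_leftTerm₀_le hv)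
  have s2 : Summable fun n => (aperyNat n : ℂ) * rightTerm n v :=
    Summable.of_norm_bounded (summable_geometric_eighth 2) (norm_rightTerm_le hv)
  have e : ∑' n, leftTerm₀ n (xParam v) = ∑' n, (aperyNat n : ℂ) * rightTerm n v := by
    rw [← sub_eq_zero, ← s1.tsum_sub s2]; exact h
  have e2 : ∑' n, (aperyNat n : ℂ) * rightTerm n v = (1 + 5 * v + 8 * v ^ 2) * (1 + 4 * v)⁻¹ ^ 2 *
      ∑' n : ℕ, (apery n : ℂ) * (v / (1 + 4 * v) ^ 3) ^ n := by
    rw [← tsum_mul_left]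
    refine tsum_congr fun n => ?_
    rw [← tParam_eq, apery_natCast, rightTerm]; ring
  -- Restores the factor `1 + x = (1 + 2v)(1 + 4v) / (1 + 5v + 8v²)` by which both sides had been
  -- divided.
  have e3 : (1 + 2 * v) / (1 + 4 * v) =
      (1 + xParam v) * ((1 + 5 * v + 8 * v ^ 2) * (1 + 4 * v)⁻¹ ^ 2) := by
    have h4 := hv.four
    have hm : (1 + xParam v) * ((1 + 5 * v + 8 * v ^ 2) * (1 + 4 * v)⁻¹ ^ 2) =
        (1 + 2 * v) * (1 + 4 * v) * (1 + 4 * v)⁻¹ ^ 2 := by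
      linear_combination (1 + 4 * v)⁻¹ ^ 2 * hv.xParam_mul
    rw [hm]
    field_simp
  rw [e3, mul_assoc, ← e2, ← e]
  exact (s1.hasSum.mul_left (1 + xParam v)).congr_fun fun n => left_term_eq hv n

theorem theorem1 :
    -- the two generating-function identities, for all complex `v` near the origin
    (∀ᶠ v : ℂ in 𝓝 0,
      zParam v = v * (1 + 5 * v + 8 * v ^ 2) / ((1 + 2 * v) ^ 2 * (1 + 4 * v) ^ 2) ∧
      Summable (fun n : ℕ => (apery n : ℂ) * (v / (1 + 4 * v) ^ 3) ^ n) ∧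
      HasSum (fun n : ℕ => ((2 * n).choose n : ℂ) * zParam v ^ n * innerSum n (xParam v))
        ((1 + 2 * v) / (1 + 4 * v) *
          ∑' n : ℕ, (apery n : ℂ) * (v / (1 + 4 * v) ^ 3) ^ n) ∧
      yParam v ^ 2 = 1 + 4 * xParam v ∧
      HasSum (fun n : ℕ => ((2 * n).choose n : ℂ) * legendreP n (yParam v) ^ 2 *
          (v * (1 + 5 * v + 8 * v ^ 2) / ((1 + 2 * v) ^ 2 * (1 + 4 * v) ^ 2)) ^ n)
        ((1 + 2 * v) / (1 + 4 * v) *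
          ∑' n : ℕ, (apery n : ℂ) * (v / (1 + 4 * v) ^ 3) ^ n)) ∧
    -- the two binomial-sum formulas for `u_n`
    (∀ n : ℕ,
      apery n = ∑ k ∈ Finset.range (n + 1),
        (n.choose k : ℤ) ^ 2 * ((n + k).choose n : ℤ) * ((2 * k).choose n : ℤ) ∧
      apery n = ∑ k ∈ Finset.range (n + 1),
        (-1 : ℤ) ^ (n - k) * ((3 * n + 1).choose (n - k) : ℤ) * ((n + k).choose n : ℤ) ^ 3) ∧
    -- the three-term recurrence with its initial values
    apery (-1) = 0 ∧ apery 0 = 1 ∧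
    (∀ n : ℕ,
      ((n : ℤ) + 1) ^ 3 * apery ((n : ℤ) + 1) =
        (2 * (n : ℤ) + 1) * (13 * (n : ℤ) ^ 2 + 13 * (n : ℤ) + 4) * apery (n : ℤ) +
          3 * (n : ℤ) * (3 * (n : ℤ) - 1) * (3 * (n : ℤ) + 1) * apery ((n : ℤ) - 1)) := by
  refine ⟨?_, fun n => ⟨rfl, aperyNat_eq_alternating_sum n⟩, apery_neg_one, aperyNat_zero,
    apery_recurrence⟩
  filter_upwards [eventually_admissible, eventually_tsum_diffTerm_eq_zero] with v hv h
  have hL := hasSum_left hv h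
  refine ⟨zParam_eq hv, summable_apery hv, hL, yParam_sq hv, ?_⟩
  rw [← zParam_eq hv]
  refine hL.congr_fun fun n => ?_
  rw [legendreP_sq n (yParam_sq hv)]
  ring
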